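/- **Higher-order fixpoint logic (HFL).** Types are $\tau ::= \mathsf{Pr}\mid \sigma^v\to\tau$ with variances $v\in\{+,-,0\}$; formulas are $\varphi ::= q\mid X\mid\neg\varphi\mid\varphi\vee\varphi\mid\langle a\rangle\varphi\mid\varphi\,\varphi\mid\lambda(X^v{:}\tau).\varphi\mid\mu(X{:}\tau).\varphi$, with the usual type rules $\Gamma\vdash\varphi:\tau$ for contexts $\Gamma$ of variables with variances and types ($\Gamma^-$ exchanges $+$ and $-$; a variable may be used with variance $0$ or $+$; $\Gamma\vdash\neg\varphi:\tau$ if $\Gamma^-\vdash\varphi:\tau$; an argument of a $\sigma^v\to\tau$ function has to be typed as $\sigma$ in $\Gamma$ if $v=+$, in $\Gamma^-$ if $v=-$, in both if $v=0$; a $\mu$-bound variable has variance $+$). Over a transition system with state set $\mathcal S$, $[\![\mathsf{Pr}]\!]$ is the powerset of $\mathcal S$, and $[\![\sigma^v\to\tau]\!]$ is the lattice of functions $[\![\sigma]\!]\to[\![\tau]\!]$, ordered pointwise, that are monotone ($v=+$), antitone ($v=-$), arbitrary ($v=0$). Formulas are interpreted as usual; $\neg$ is the (pointwise) complement and $\mu(X{:}\tau).\varphi$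 the infimum in $[\![\tau]\!]$ of all $x$ with $[\![\varphi]\!]_{\eta[X\mapsto x]}\sqsubseteq x$. A simultaneous least fixpoint $\mu X_i.(X_1.\varphi_1,\dots,X_m.\varphi_m)$ abbreviates the formula $\mu X_i.\varphi_i'$ obtained by recursively replacing in $\varphi_i$ each $X_j$ that is not yet bound by its own, likewise expanded, least fixpoint. $\wedge,\to,\leftrightarrow,[a]$ are the usual abbreviations, $\mathtt{ff}:=\mu(X{:}\mathsf{Pr}).X$, $\mathtt{tt}:=\neg\mathtt{ff}$, and $\mathtt{if}\ \beta\ \mathtt{then}\ \varphi\ \mathtt{else}\ \psi:=(\beta\wedge\varphi)\vee(\neg\beta\wedge\psi)$. Empty disjunctions are $\mathtt{ff}$, empty conjunctions $\mathtt{tt}$. **Machines.** Let $F_0(m):=2^m$, $F_{k+1}(m):=2^{m\cdot F_k(m)}$. Let $p:\mathbb N\to\mathbb N$ (for instance a polynomial) satisfy $p(n)>n$ for all $n$. An alternating Turing machine $\mathcal M$ over the alphabet $\Gamma=\{\mathtt{tt},\mathtt{ff}\}$, with $\mathtt{ff}$ as the blank, has a finite state set $Q$ partitioned into existential states, universal states,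 $\{q_{acc}\}$ and $\{q_{rej}\}$, an existential or universal initial state $q_0$, and a transition relation $\delta\subseteq Q\times\Gamma\times Q\times\Gamma\times\{-1,0,+1\}$. A configuration $(q,h,t)$ consists of the state, the head position and the tape content; the initial one on $w$ is $(q_0,0,w\,\mathtt{ff}\,\mathtt{ff}\cdots)$; halting configurations (state $q_{acc}$ or $q_{rej}$) have no successors. $\mathcal M$ is $F_k(p(n))$-space bounded if in every configuration reachable on any input of length $n$ the head is in $\{0,\dots,F_k(p(n))-1\}$. It is assumed that $\mathcal M$ never gets stuck: every reachable non-halting configuration has a successor. A computation tree on $w$ is a tree of finite height whose root is the initial configuration, in which an existential configuration has exactly one of its successors as a child, the children of a universal configuration are all its successors, and the leaves are exactly the halting configurations; $w\in L(\mathcal M)$ iff some computation tree on $w$ has only accepting leaves. **The transition system.** Fix $k$, $\mathcal M$, $w=a_0\ldots a_{n-1}\in\Gamma^*$ and put $N:=p(n)$. $\mathcal T_{\mathcal M,w}$ has state set $\mathcal S=\{0,\dots,N-1\}$, no propositions, and two relations: $i\xrightarrow{lower}j$ iff $j<i$, and $i\xrightarrow{test}j$ for all $i,j$. **The formula.** Let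 $\tau_0:=\mathsf{Pr}$, $\tau_{j+1}:=\tau_j^0\to\mathsf{Pr}$; all $\lambda$-bound variables below have variance $0$. Let - $bit_0:=[lower]\mathtt{ff}$, $\ bit_{i+1}:=\langle lower\rangle bit_i\wedge[lower]\bigvee_{j\le i}bit_j$; - $inc^0:=\lambda X.\,X\leftrightarrow\langle lower\rangle\neg X$, $\ dec^0:=\lambda X.\,X\leftrightarrow\langle lower\rangle X$, $\ eq^0:=\lambda I.\lambda J.\,[test](I\leftrightarrow J)$, $\ lt^0:=\lambda I.\lambda J.\bigvee_{i<N}[test]\big((bit_i\to\neg I\wedge J)\wedge\bigwedge_{i<h<N}(bit_h\to(I\leftrightarrow J))\big)$; - $min^0:=\mathtt{ff}$, $\ max^0:=\mathtt{tt}$, $\ min^{j+1}:=\lambda X.min^0$; - $exists^j:=\lambda P.\big(\mu Z.\lambda X.(P\,X)\vee Z\,(inc^j\,X)\big)\,min^j$, $\ forall^j:=\lambda P.\neg(exists^j\,(\neg P))$, $\ gt^j:=\lambda I.\lambda J.\,lt^j\,J\,I$; - $eq^{j+1}:=\lambda I.\lambda J.\,forall^j(\lambda X.\,eq^0(I\,X)(J\,X))$;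 - $lt^{j+1}:=\lambda I.\lambda J.\,exists^j\big(\lambda X.\,lt^0(I\,X)(J\,X)\wedge forall^j(\lambda Y.\,gt^j\,Y\,X\to eq^0(I\,Y)(J\,Y))\big)$; - $inc^{j+1}:=\lambda I.\lambda X.\,\mathtt{if}\ exists^j(\lambda Y.\,lt^j\,Y\,X\wedge\neg\,eq^0(I\,Y)\,max^0)\ \mathtt{then}\ I\,X\ \mathtt{else}\ inc^0(I\,X)$, and $dec^{j+1}$ likewise with $min^0$, $dec^0$ in place of $max^0$, $inc^0$; - $\mathtt{case}^j\ (\alpha_h:\psi_h)_h\ \mathtt{else}\ \psi:=\lambda I.\,\bigvee_h(eq^j\,I\,\alpha_h\wedge\psi_h)\ \vee\ \big(\psi\wedge\bigwedge_h(\neg\,eq^j\,I\,\alpha_h\vee\neg\psi_h)\big)$; - $\chi^0_i:=\bigvee\{bit_j: j<N,\ \text{the }j\text{-th binary digit of }i\text{ is }1\}$, $\ \chi^{j+1}_i:=\mathtt{case}^{j}\ min^{j}:\chi^0_i\ \mathtt{else}\ min^0$; - $tape^k_0:=\mathtt{case}^k\ \chi^k_0:a_0,\dots,\chi^k_{n-1}:a_{n-1}\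 \mathtt{else}\ \mathtt{ff}$, $\ head^k_0:=min^k$; - $read^k_{\mathtt{tt}}:=\lambda T.\lambda H.\,T\,H$, $\ read^k_{\mathtt{ff}}:=\lambda T.\lambda H.\neg(T\,H)$, $\ write^k_a:=\lambda T.\lambda H.\lambda H'.\,\mathtt{if}\ eq^k\,H\,H'\ \mathtt{then}\ a\ \mathtt{else}\ T\,H'$; - $move^k_{-1}:=dec^k$, $\ move^k_0:=\lambda H.H$, $\ move^k_{+1}:=inc^k$. With a fixpoint variable of type $\tau_{k+1}^0\to\tau_k^0\to\mathsf{Pr}$ for each state, let $\Psi^k_{\mathcal M,q_0}$ be the $q_0$-component of the simultaneous least fixpoint with the equations $q_{acc}.\,\lambda T.\lambda H.\mathtt{tt}$, $\ q_{rej}.\,\lambda T.\lambda H.\mathtt{ff}$, and, for every other state $q$, $$q.\ \lambda T.\lambda H.\bigvee_{a\in\Gamma}\Big(read^k_a\,T\,H\ \wedge\bigcirc_{(q',b,d)\in\delta(q,a)}q'\,(write^k_b\,T\,H)\,(move^k_d\,H)\Big),$$ where $\bigcirc$ is $\bigvee$ if $q$ is existential and $\bigwedge$ if $q$ is universal. Finally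 let $\Phi^k_{\mathcal M,w}:=\Psi^k_{\mathcal M,q_0}\ tape^k_0\ head^k_0$. **Theorem.** For all $k\ge1$, all $w\in\Gamma^*$ and all $F_k(p(n))$-space bounded alternating Turing machines $\mathcal M$ as above, $\Phi^k_{\mathcal M,w}$ is a closed well-typed formula of type $\mathsf{Pr}$, and $$[\![\Phi^k_{\mathcal M,w}]\!]^{\mathcal T_{\mathcal M,w}}=\begin{cases}\mathcal S,&\text{if }w\in L(\mathcal M),\\ \emptyset,&\text{otherwise.}\end{cases}$$ -/

import Mathlib

noncomputable section

namespace HFL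

/-! ### Types and formulas of higher-order fixpoint logic -/

inductive Variance
  | pos
  | neg
  | zero

def Variance.compl : Variance → Variance
  | .pos => .neg
  | .neg => .pos
  | .zero => .zero

/-- The types: `pr` is the ground type, `arr σ v τ` is `σ^v → τ`. -/
inductive Ty
  | pr
  | arr (σ : Ty) (v : Variance) (τ : Ty)

/-- Formulas over propositions `P`, action names `A` and variables `V`. -/
inductive Fml (P A V : Type)
  | prop (q : P)
  | var (X : V)
  | neg (φ : Fml P A V)
  | or (φ ψ : Fml P A V)
  | dia (a : A) (φ : Fml P A V)
  | app (φ ψ : Fml P A V)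
  | lam (X : V) (v : Variance) (σ : Ty) (φ : Fml P A V)
  | mu (X : V) (τ : Ty) (φ : Fml P A V)

/-- A context assigns a variance and a type to each of its variables. -/
abbrev Ctx (V : Type) := V → Option (Variance × Ty)

namespace Ctx
variable {V : Type}

def empty : Ctx V := fun _ => none

/-- The complement of a context: all variances are complemented. -/
def compl (Γ : Ctx V) : Ctx V := fun X => (Γ X).map fun y => (y.1.compl, y.2)

open Classical in
/-- The context `Γ, X^v : τ`; a binder hides an outer binder of the same name. -/
def extend (Γ : Ctx V) (X : V) (v : Variance) (τ : Ty) : Ctx V :=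
  Function.update Γ X (some (v, τ))

end Ctx

/-- The type system: `HasType Γ φ τ` is `Γ ⊢ φ : τ`. -/
inductive HasType {P A V : Type} : Ctx V → Fml P A V → Ty → Prop
  | prop (Γ : Ctx V) (q : P) : HasType Γ (.prop q) .pr
  | var (Γ : Ctx V) (X : V) (v : Variance) (τ : Ty) (hv : v = .zero ∨ v = .pos)
      (h : Γ X = some (v, τ)) : HasType Γ (.var X) τ
  | neg (Γ : Ctx V) (φ : Fml P A V) (τ : Ty) (h : HasType Γ.compl φ τ) : HasType Γ (.neg φ) τ
  | or (Γ : Ctx V) (φ ψ : Fml P A V) (h₁ : HasType Γ φ .pr) (h₂ : HasType Γ ψ .pr) :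
      HasType Γ (.or φ ψ) .pr
  | dia (Γ : Ctx V) (a : A) (φ : Fml P A V) (h : HasType Γ φ .pr) : HasType Γ (.dia a φ) .pr
  | lam (Γ : Ctx V) (X : V) (v : Variance) (σ τ : Ty) (φ : Fml P A V)
      (h : HasType (Γ.extend X v σ) φ τ) : HasType Γ (.lam X v σ φ) (.arr σ v τ)
  | appPos (Γ : Ctx V) (φ ψ : Fml P A V) (σ τ : Ty) (h₁ : HasType Γ φ (.arr σ .pos τ))
      (h₂ : HasType Γ ψ σ) : HasType Γ (.app φ ψ) τ
  | appNeg (Γ : Ctx V) (φ ψ : Fml P A V) (σ τ : Ty) (h₁ : HasType Γ φ (.arr σ .neg τ))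
      (h₂ : HasType Γ.compl ψ σ) : HasType Γ (.app φ ψ) τ
  | appZero (Γ : Ctx V) (φ ψ : Fml P A V) (σ τ : Ty) (h₁ : HasType Γ φ (.arr σ .zero τ))
      (h₂ : HasType Γ ψ σ) (h₃ : HasType Γ.compl ψ σ) : HasType Γ (.app φ ψ) τ
  | mu (Γ : Ctx V) (X : V) (τ : Ty) (φ : Fml P A V)
      (h : HasType (Γ.extend X .pos τ) φ τ) : HasType Γ (.mu X τ φ) τ

/-! ### Semantics -/

/-- A labelled transition system with state set `S`. -/
structure LTS (S P A : Type) where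
  tr : A → S → S → Prop
  label : S → Set P

/-- The order on the argument side of a function type: unchanged for `+`, reversed for `-`,
flattened for `0`. -/
@[reducible] def Variance.preorder (v : Variance) (α : Type) [PartialOrder α] : Preorder α :=
  match v with
  | .pos => inferInstance
  | .neg =>
    { le := fun a b => b ≤ a
      lt := fun a b => b ≤ a ∧ ¬ a ≤ b
      le_refl := fun _ => le_rfl
      le_trans := fun _ _ _ h₁ h₂ => le_trans h₂ h₁ }
  | .zero =>
    { le := fun a b => a ≤ b ∧ b ≤ a
      lt := fun a b => (a ≤ b ∧ b ≤ a) ∧ ¬ (b ≤ a ∧ a ≤ b)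
      le_refl := fun _ => ⟨le_rfl, le_rfl⟩
      le_trans := fun _ _ _ h₁ h₂ => ⟨h₁.1.trans h₂.1, h₂.2.trans h₁.2⟩ }

/-- The complete lattice denoted by a type: the powerset of `S` for `pr`, and the monotone
functions from `⟦σ⟧^v` to `⟦τ⟧`, ordered pointwise, for `σ^v → τ`. -/
def Ty.lattice (S : Type) : Ty → (α : Type) × CompleteLattice α
  | .pr => ⟨Set S, inferInstance⟩
  | .arr σ v τ =>
    letI := (Ty.lattice S σ).2
    letI := (Ty.lattice S τ).2
    letI := v.preorder (Ty.lattice S σ).1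
    ⟨(Ty.lattice S σ).1 →o (Ty.lattice S τ).1, inferInstance⟩

/-- The semantic domain `⟦τ⟧`. -/
def Dom (S : Type) (τ : Ty) : Type := (Ty.lattice S τ).1

instance (S : Type) (τ : Ty) : CompleteLattice (Dom S τ) := (Ty.lattice S τ).2

/-- A set of states as an element of the ground domain. -/
def Dom.ofSet {S : Type} (s : Set S) : Dom S .pr := s

def Dom.toSet {S : Type} (x : Dom S .pr) : Set S := x

/-- Application of a semantic function to a semantic argument. -/
def Dom.ap {S : Type} {σ τ : Ty} {v : Variance} (f : Dom S (.arr σ v τ)) (x : Dom S σ) :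
    Dom S τ :=
  letI := (Ty.lattice S σ).2
  letI := (Ty.lattice S τ).2
  letI := v.preorder (Ty.lattice S σ).1
  (show (Ty.lattice S σ).1 →o (Ty.lattice S τ).1 from f) x

/-- `IsNeg τ f g`: `f` is the complement of `g`, taken pointwise at function types. -/
def IsNeg {S : Type} : (τ : Ty) → Dom S τ → Dom S τ → Prop
  | .pr, f, g => Dom.toSet f = (Dom.toSet g)ᶜ
  | .arr _ _ τ, f, g => ∀ x, IsNeg τ (Dom.ap f x) (Dom.ap g x)

/-- A semantic value together with its type. -/
abbrev Val (S : Type) := (τ : Ty) × Dom S τ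

/-- Environments are partial maps from variables to semantic values. -/
abbrev Env (S V : Type) := V → Option (Val S)

def Env.empty {S V : Type} : Env S V := fun _ => none

open Classical in
/-- The environment `η[X ↦ x]`. -/
def Env.set {S V : Type} (η : Env S V) (X : V) {τ : Ty} (x : Dom S τ) : Env S V :=
  Function.update η X (some ⟨τ, x⟩)

open Classical in
/-- The semantics of a formula in an environment; `none` when the formula has no type or the
element described by a clause does not exist in the domain of its type. -/
def den {S P A V : Type} (T : LTS S P A) : Fml P A V → Env S V → Option (Val S)
  | .prop q, _ => some ⟨.pr, Dom.ofSet {s | q ∈ T.label s}⟩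
  | .var X, η => η X
  | .neg φ, η =>
    match den T φ η with
    | some ⟨τ, g⟩ => if h : ∃ f, IsNeg τ f g then some ⟨τ, h.choose⟩ else none
    | none => none
  | .or φ ψ, η =>
    match den T φ η, den T ψ η with
    | some ⟨.pr, x⟩, some ⟨.pr, y⟩ => some ⟨.pr, Dom.ofSet (Dom.toSet x ∪ Dom.toSet y)⟩
    | _, _ => none
  | .dia a φ, η =>
    match den T φ η with
    | some ⟨.pr, x⟩ => some ⟨.pr, Dom.ofSet {s | ∃ t, T.tr a s t ∧ t ∈ Dom.toSet x}⟩
    | _ => none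
  | .app φ ψ, η =>
    match den T φ η, den T ψ η with
    | some ⟨.arr σ _ τ, f⟩, some ⟨σ', x⟩ =>
      if h : σ' = σ then some ⟨τ, Dom.ap f (h ▸ x)⟩ else none
    | _, _ => none
  | .lam X v σ φ, η =>
    if h : ∃ (τ : Ty) (f : Dom S (.arr σ v τ)),
        ∀ x : Dom S σ, den T φ (η.set X x) = some ⟨τ, Dom.ap f x⟩ then
      some ⟨.arr σ v h.choose, h.choose_spec.choose⟩
    else none
  | .mu X τ φ, η =>
    if h : ∃ F : Dom S τ → Dom S τ, ∀ x : Dom S τ, den T φ (η.set X x) = some ⟨τ, F x⟩ then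
      some ⟨τ, sInf {x | h.choose x ≤ x}⟩
    else none

/-! ### Abbreviations -/

namespace Fml
variable {P A V : Type}

def and (φ ψ : Fml P A V) : Fml P A V := .neg (.or (.neg φ) (.neg ψ))

def imp (φ ψ : Fml P A V) : Fml P A V := .or (.neg φ) ψ

def iff (φ ψ : Fml P A V) : Fml P A V := and (imp φ ψ) (imp ψ φ)

def box (a : A) (φ : Fml P A V) : Fml P A V := .neg (.dia a (.neg φ))

/-- `if β then φ else ψ` -/
def ite (β φ ψ : Fml P A V) : Fml P A V := .or (and β φ) (and (.neg β) ψ)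

end Fml

/-! ### Alternating Turing machines over the two letters `true`, `false` (the blank) -/

inductive Kind
  | exist
  | univ
  | acc
  | rej

/-- A head movement by `-1`, `0` or `+1`. -/
inductive Dir
  | left
  | stay
  | right

def Dir.toInt : Dir → ℤ
  | .left => -1
  | .stay => 0
  | .right => 1

/-- `kind` partitions the states into the existential ones, the universal ones, `{qacc}` and
`{qrej}`. -/
structure ATM (Q : Type) where
  kind : Q → Kind
  q0 : Q
  qacc : Q
  qrej : Q
  delta : Finset (Q × Bool × Q × Bool × Dir)
  kind_q0 : kind q0 = .exist ∨ kind q0 = .univ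
  kind_acc : ∀ q, kind q = .acc ↔ q = qacc
  kind_rej : ∀ q, kind q = .rej ↔ q = qrej

structure Config (Q : Type) where
  state : Q
  head : ℤ
  tape : ℤ → Bool

namespace ATM
variable {Q : Type} (M : ATM Q)

/-- The input stands on the cells `0, …, n - 1`, all other cells are blank. -/
def init (w : List Bool) : Config Q where
  state := M.q0
  head := 0
  tape := fun i => if 0 ≤ i then w.getD i.toNat false else false

def Halting (c : Config Q) : Prop := M.kind c.state = .acc ∨ M.kind c.state = .rej

/-- The successor relation; halting configurations have no successors. -/
def Step (c c' : Config Q) : Prop :=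
  ¬ M.Halting c ∧ ∃ (b : Bool) (d : Dir),
    (c.state, c.tape c.head, c'.state, b, d) ∈ M.delta ∧
    c'.head = c.head + d.toInt ∧
    c'.tape = Function.update c.tape c.head b

def Reachable (w : List Bool) (c : Config Q) : Prop :=
  Relation.ReflTransGen M.Step (M.init w) c

/-- On inputs of length `n`, only the cells `0, …, f n - 1` are ever visited. -/
def SpaceBounded (f : ℕ → ℕ) : Prop :=
  ∀ (w : List Bool) (c : Config Q), M.Reachable w c → 0 ≤ c.head ∧ c.head < (f w.length : ℤ)

/-- Only accepting and rejecting configurations lack a successor. -/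
def NeverStuck : Prop :=
  ∀ (w : List Bool) (c : Config Q), M.Reachable w c → ¬ M.Halting c → ∃ c', M.Step c c'

/-- Finite-height computation trees: the leaves are the halting configurations, an existential
configuration has exactly one of its successors as its child, and the children of a universal
configuration are all its successors, of which there is at least one. -/
inductive CompTree : Config Q → Type
  | leaf (c : Config Q) (h : M.Halting c) : CompTree c
  | exist (c c' : Config Q) (h : M.kind c.state = .exist) (hs : M.Step c c')
      (t : CompTree c') : CompTree c
  | univ (c : Config Q) (h : M.kind c.state = .univ) (hs : ∃ c', M.Step c c')
      (t : ∀ c', M.Step c c' → CompTree c') : CompTree c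

/-- All leaves are accepting. -/
def CompTree.Accepting {M : ATM Q} : {c : Config Q} → M.CompTree c → Prop
  | _, .leaf c _ => M.kind c.state = .acc
  | _, .exist _ _ _ _ t => t.Accepting
  | _, .univ c _ _ t => ∀ (c' : Config Q) (hs : M.Step c c'), (t c' hs).Accepting

/-- The language accepted by the machine. -/
def language : Set (List Bool) := {w | ∃ t : M.CompTree (M.init w), t.Accepting}

end ATM

/-! ### The reduction -/

/-- `F_0(m) = 2^m`, `F_{k+1}(m) = 2^(m * F_k(m))`. -/
def F : ℕ → ℕ → ℕ
  | 0, m => 2 ^ m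
  | k + 1, m => 2 ^ (m * F k m)

inductive Act
  | lower
  | test

/-- The transition system with states `0, …, N - 1`, `i --lower--> j` iff `j < i`,
`i --test--> j` always, and no propositions. -/
def sys (N : ℕ) : LTS (Fin N) Empty Act where
  tr := fun a i j =>
    match a with
    | .lower => j < i
    | .test => True
  label := fun _ => ∅

/-- Variable names; each state of the machine is also a variable. -/
inductive Vr (Q : Type)
  | P
  | X
  | Y
  | Z
  | I
  | J
  | T
  | H
  | K
  | st (q : Q)

/-- Formulas over the empty set of propositions and the actions `lower`, `test`. -/
abbrev Form (Q : Type) := Fml Empty Act (Vr Q)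

/-- The types `τ_0 = Pr`, `τ_{k+1} = τ_k → Pr`. All argument variances are `0`, so that `τ_{k+1}`
denotes the set of all functions. -/
def tau : ℕ → Ty
  | 0 => .pr
  | k + 1 => .arr (tau k) .zero .pr

section Macros
variable {Q : Type}

def v (x : Vr Q) : Form Q := .var x

/-- `λ (x^0 : τ). φ` -/
def lam (x : Vr Q) (τ : Ty) (φ : Form Q) : Form Q := .lam x .zero τ φ

def app2 (f a b : Form Q) : Form Q := .app (.app f a) b

/-- There are no propositions here, so falsity is the closed formula `μ (X : Pr). X`. -/
def ff : Form Q := .mu .X .pr (.var .X)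

def tt : Form Q := .neg ff

def bigOr (l : List (Form Q)) : Form Q := l.foldr .or ff

def bigAnd (l : List (Form Q)) : Form Q := l.foldr Fml.and tt

/-- `bit i` holds exactly in the state `i`. -/
def bit : ℕ → Form Q
  | 0 => .box .lower ff
  | i + 1 =>
    .and (.dia .lower (bit i))
      (.box .lower (bigOr ((List.finRange (i + 1)).map fun j => bit j.1)))
termination_by i => i
decreasing_by
  · omega
  · exact j.2

def inc0 : Form Q := lam .X .pr (.iff (v .X) (.dia .lower (.neg (v .X))))

def dec0 : Form Q := lam .X .pr (.iff (v .X) (.dia .lower (v .X)))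

def eq0 : Form Q := lam .I .pr (lam .J .pr (.box .test (.iff (v .I) (v .J))))

/-- `λI. λJ. ⋁_{k < N} [test]((bit_k → ¬I ∧ J) ∧ ⋀_{k < h < N} (bit_h → (I ↔ J)))` -/
def lt0 (N : ℕ) : Form Q :=
  lam .I .pr (lam .J .pr (bigOr ((List.range N).map fun k =>
    .box .test (.and (.imp (bit k) (.and (.neg (v .I)) (v .J)))
      (bigAnd (((List.range N).filter fun h => k < h).map fun h =>
        .imp (bit h) (.iff (v .I) (v .J))))))))

def minF : ℕ → Form Q
  | 0 => ff
  | k + 1 => lam .X (tau k) ff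

def max0 : Form Q := tt

/-- `λP. (μZ. λX. P X ∨ Z (inc X)) min^k`, where `inc` is the increment at level `k`. -/
def existsOf (k : ℕ) (inc : Form Q) : Form Q :=
  lam .P (tau (k + 1))
    (.app
      (.mu .Z (tau (k + 1))
        (lam .X (tau k)
          (.or (.app (v .P) (v .X)) (.app (v .Z) (.app inc (v .X))))))
      (minF k))

/-- `λP. ¬ (exists^k (¬ P))` -/
def forallOf (k : ℕ) (inc : Form Q) : Form Q :=
  lam .P (tau (k + 1)) (.neg (.app (existsOf k inc) (.neg (v .P))))

/-- `λI. λJ. lt J I`, where `lt` is the less-than test at level `k`. -/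
def gtOf (k : ℕ) (lt : Form Q) : Form Q :=
  lam .I (tau k) (lam .J (tau k) (app2 lt (v .J) (v .I)))

/-- The common shape of `inc^{k+1}` and `dec^{k+1}`:
`λI. λX. if exists^k (λY. lt^k Y X ∧ ¬ eq^0 (I Y) e) then I X else s (I X)`. -/
def stepOf (k : ℕ) (inc lt e s : Form Q) : Form Q :=
  lam .I (tau (k + 1)) (lam .X (tau k)
    (.ite
      (.app (existsOf k inc) (lam .Y (tau k)
        (.and (app2 lt (v .Y) (v .X)) (.neg (app2 eq0 (.app (v .I) (v .Y)) e)))))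
      (.app (v .I) (v .X))
      (.app s (.app (v .I) (v .X)))))

mutual

def inc (N : ℕ) : ℕ → Form Q
  | 0 => inc0
  | k + 1 => stepOf k (inc N k) (lt N k) max0 inc0

/-- At level `k + 1`: `λI. λJ. exists^k (λX. lt^0 (I X) (J X) ∧
forall^k (λY. gt^k Y X → eq^0 (I Y) (J Y)))`. -/
def lt (N : ℕ) : ℕ → Form Q
  | 0 => lt0 N
  | k + 1 =>
    lam .I (tau (k + 1)) (lam .J (tau (k + 1))
      (.app (existsOf k (inc N k)) (lam .X (tau k)
        (.and (app2 (lt0 N) (.app (v .I) (v .X)) (.app (v .J) (v .X)))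
          (.app (forallOf k (inc N k)) (lam .Y (tau k)
            (.imp (app2 (gtOf k (lt N k)) (v .Y) (v .X))
              (app2 eq0 (.app (v .I) (v .Y)) (.app (v .J) (v .Y))))))))))

end

def dec (N : ℕ) : ℕ → Form Q
  | 0 => dec0
  | k + 1 => stepOf k (inc N k) (lt N k) (minF 0) dec0

/-- At level `k + 1`: `λI. λJ. forall^k (λX. eq^0 (I X) (J X))`. -/
def eq (N : ℕ) : ℕ → Form Q
  | 0 => eq0
  | k + 1 =>
    lam .I (tau (k + 1)) (lam .J (tau (k + 1))
      (.app (forallOf k (inc N k)) (lam .X (tau k)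
        (app2 eq0 (.app (v .I) (v .X)) (.app (v .J) (v .X))))))

/-- `case^k j_1 : ψ_1, …, j_m : ψ_m else ψ`, that is
`λI. (⋁_h (eq^k I j_h ∧ ψ_h)) ∨ (ψ ∧ ⋀_h (¬ eq^k I j_h ∨ ¬ ψ_h))`, for closed `j_h`, `ψ_h`, `ψ`. -/
def caseOf (N k : ℕ) (l : List (Form Q × Form Q)) (ψ : Form Q) : Form Q :=
  lam .I (tau k)
    (.or
      (bigOr (l.map fun y => .and (app2 (eq N k) (v .I) y.1) y.2))
      (.and ψ (bigAnd (l.map fun y => .or (.neg (app2 (eq N k) (v .I) y.1)) (.neg y.2)))))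

/-- The number `i` at level `0`: the disjunction of `bit_j` over the set bits `j` of `i`. -/
def chi0 (N i : ℕ) : Form Q :=
  bigOr (((List.range N).filter fun j => i.testBit j).map bit)

/-- `chi N k i` denotes the number `i` at level `k`, for small `i`. -/
def chi (N : ℕ) : ℕ → ℕ → Form Q
  | 0, i => chi0 N i
  | k + 1, i => caseOf N k [(minF k, chi0 N i)] (minF 0)

/-- The letters `true`, `false` are encoded by the propositions `tt`, `ff`. -/
def letter : Bool → Form Q
  | true => tt
  | false => ff

/-- The initial tape content. -/
def tape0 (N k : ℕ) (w : List Bool) : Form Q :=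
  caseOf N k (w.zipIdx.map fun y => (chi N k y.2, letter y.1)) ff

def head0 (k : ℕ) : Form Q := minF k

def read (k : ℕ) (a : Bool) : Form Q :=
  lam .T (tau (k + 1)) (lam .H (tau k)
    (match a with
    | true => .app (v .T) (v .H)
    | false => .neg (.app (v .T) (v .H))))

/-- `λT. λH. λK. if eq^k H K then a else T K` -/
def write (N k : ℕ) (a : Bool) : Form Q :=
  lam .T (tau (k + 1)) (lam .H (tau k) (lam .K (tau k)
    (.ite (app2 (eq N k) (v .H) (v .K)) (letter a) (.app (v .T) (v .K)))))

def move (N k : ℕ) : Dir → Form Q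
  | .left => dec N k
  | .stay => lam .H (tau k) (v .H)
  | .right => inc N k

/-- The type `τ_{k+1} → τ_k → Pr` of the fixpoint variables. -/
def stTy (k : ℕ) : Ty := .arr (tau (k + 1)) .zero (.arr (tau k) .zero .pr)

variable [DecidableEq Q]

/-- `q' (write_b T H) (move_d H)` for each `(q', b, d) ∈ δ(q, a)`, where `r q'` stands for `q'`. -/
def succs (N k : ℕ) (M : ATM Q) (r : Q → Form Q) (q : Q) (a : Bool) : List (Form Q) :=
  (M.delta.filter fun e => e.1 = q ∧ e.2.1 = a).toList.map fun e =>
    app2 (r e.2.2.1) (app2 (write N k e.2.2.2.1) (v .T) (v .H))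
      (.app (move N k e.2.2.2.2) (v .H))

/-- The equation for the state `q` in the simultaneous fixpoint, with `r q'` in place of each
fixpoint variable `q'`. -/
def row (N k : ℕ) (M : ATM Q) (q : Q) (r : Q → Form Q) : Form Q :=
  lam .T (tau (k + 1)) (lam .H (tau k)
    (match M.kind q with
    | .acc => tt
    | .rej => ff
    | .exist => bigOr ([true, false].map fun a =>
        .and (app2 (read k a) (v .T) (v .H)) (bigOr (succs N k M r q a)))
    | .univ => bigOr ([true, false].map fun a =>
        .and (app2 (read k a) (v .T) (v .H)) (bigAnd (succs N k M r q a)))))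

/-- The component `q` of a simultaneous least fixpoint of type `τ` as an ordinary formula:
a variable in `B` is already bound further out and is left as it is, any other variable is replaced
by its own least fixpoint, inside of which it is bound as well. -/
def simMu [Fintype Q] (τ : Ty) (rows : Q → (Q → Form Q) → Form Q) (B : Finset Q) (q : Q) :
    Form Q :=
  if _h : q ∈ B then .var (.st q)
  else .mu (.st q) τ (rows q fun q' => simMu τ rows (insert q B) q')
termination_by Bᶜ.card
decreasing_by
  apply Finset.card_lt_card
  rw [Finset.compl_ssubset_compl]
  exact Finset.ssubset_insert _h

/-- `Ψ_{M,q}`: the component `q` of the simultaneous least fixpoint. -/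
def Psi [Fintype Q] (N k : ℕ) (M : ATM Q) (q : Q) : Form Q :=
  simMu (stTy k) (row N k M) ∅ q

/-- The formula `Φ^k_{M,w}`, for a transition system with `N` states. -/
def Phi [Fintype Q] (N k : ℕ) (M : ATM Q) (w : List Bool) : Form Q :=
  app2 (Psi N k M M.q0) (tape0 N k w) (head0 k)

end Macros

end HFL

end

namespace HFL

/-! ### Finite counters -/

-- The domain of `tau k` over `N` states is finite with exactly `F k N` elements, so its elements
-- can serve as the addresses of the tape cells, and a predicate on them, an element of the domain
-- of `tau (k + 1)`, as a tape content. The proof makes this precise and then compares a least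
-- fixpoint with acceptance.
--
-- Arithmetic. Each domain carries a `Counter`: sets of states are binary numbers with `N` digits,
-- and a function into them is a number whose digits are sets of states, indexed by the counter one
-- level below. The axioms make every value an iterate `ofNat i` of the increment from the minimum,
-- injectively for `i` below the cardinality. Nothing more is needed to identify values with cells.
-- Induction on the level shows that the formulas denote the counter operations. The quantifier
-- works since its fixpoint visits every value reachable from the minimum by increments, and these
-- are all values.
--
-- Fixpoints. Nested least fixpoints solve the simultaneous system (Bekić): `simSol_le` and
-- `row_simSol_le` say that `simSol` is the least prefixed point of the rows.
--
-- Simulation. At the encoding of a reachable configuration, a row computes one move of the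
-- alternating game (`mem_valDom_rowDom`); the space bound excludes wrap-around. If the input is
-- accepted, induction on an accepting tree places the initial configuration in every prefixed
-- point, in particular in the least one. Conversely, the vector `boundDom`, which records the
-- existence of accepting trees, is itself prefixed, so the least fixpoint lies below it.
--
-- Typing. All λ-bound variables have variance `0`, so the macros have the same type in a context
-- and in its complement (`BiType`). Fixpoint variables are merely positive, but they occur only in
-- function position, where no typing in the complement is required.

/-- A strict total order with mutually inverse increment and decrement operations that wrap around
between a least element `min` and an element `max`. -/
structure Counter (α : Type) where
  lt : α → α → Prop
  inc : α → α
  dec : α → α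
  min : α
  max : α
  irrefl : ∀ x, ¬ lt x x
  trans : ∀ x y z, lt x y → lt y z → lt x z
  tri : ∀ x y, x = y ∨ lt x y ∨ lt y x
  inc_dec : ∀ x, inc (dec x) = x
  dec_inc : ∀ x, dec (inc x) = x
  dec_min : dec min = max
  dec_lt : ∀ x, x ≠ min → lt (dec x) x
  not_lt_min : ∀ x, ¬ lt x min

namespace Counter

theorem wellFounded_of_finite {α : Type} [Finite α] {r : α → α → Prop} (irrefl : ∀ x, ¬ r x x)
    (trans : ∀ x y z, r x y → r y z → r x z) : WellFounded r :=
  haveI : Std.Irrefl r := ⟨irrefl⟩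
  haveI : IsTrans α r := ⟨trans⟩
  Finite.wellFounded_of_trans_of_irrefl r

section
variable {α : Type} (c : Counter α)

theorem inc_max : c.inc c.max = c.min := by rw [← c.dec_min, c.inc_dec]

theorem dec_eq_max_iff (x : α) : c.dec x = c.max ↔ x = c.min := by
  constructor
  · intro h
    rw [← c.inc_dec x, h, c.inc_max]
  · rintro rfl
    exact c.dec_min

theorem inc_eq_min_iff (x : α) : c.inc x = c.min ↔ x = c.max := by
  rw [← c.dec_eq_max_iff, c.dec_inc, eq_comm]

theorem min_lt (x : α) (h : x ≠ c.min) : c.lt c.min x := by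
  rcases c.tri x c.min with h' | h' | h'
  · exact absurd h' h
  · exact absurd h' (c.not_lt_min x)
  · exact h'

/-- The number `i` as a counter value. -/
def ofNat (i : ℕ) : α := c.inc^[i] c.min

theorem ofNat_zero : c.ofNat 0 = c.min := rfl

theorem ofNat_succ (i : ℕ) : c.ofNat (i + 1) = c.inc (c.ofNat i) :=
  Function.iterate_succ_apply' _ _ _

theorem dec_ofNat_succ (i : ℕ) : c.dec (c.ofNat (i + 1)) = c.ofNat i := by
  rw [ofNat_succ, dec_inc]

/-- Descent along the order: `dec` strictly decreases every value but the minimum, so finitely many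
decrements lead to the minimum, and `inc` retraces them. -/
theorem exists_ofNat_eq [Finite α] (x : α) : ∃ i, c.ofNat i = x := by
  induction x using (wellFounded_of_finite c.irrefl c.trans).induction with
  | _ x ih =>
    by_cases hx : x = c.min
    · exact ⟨0, hx.symm⟩
    · obtain ⟨i, hi⟩ := ih _ (c.dec_lt x hx)
      exact ⟨i + 1, by rw [ofNat_succ, hi, inc_dec]⟩

theorem ofNat_add_eq (i d : ℕ) (h : c.ofNat i = c.ofNat (i + d)) : c.ofNat d = c.min := by
  induction i with
  | zero => rw [Nat.zero_add] at h; exact h.symm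
  | succ i ih =>
    apply ih
    rw [← dec_ofNat_succ, h, Nat.add_right_comm, dec_ofNat_succ]

theorem ofNat_add_of_period {d : ℕ} (h : c.ofNat d = c.min) (i : ℕ) :
    c.ofNat (i + d) = c.ofNat i := by
  induction i with
  | zero => rw [Nat.zero_add]; exact h
  | succ i ih => rw [Nat.add_right_comm, ofNat_succ, ih, ofNat_succ]

/-- Every value is some `ofNat i`, and under the period `d` the index may be reduced modulo `d`. For
`ofNat_injOn` this excludes a collision before all values have been used. -/
theorem card_le_of_period [Finite α] {d : ℕ} (hd : 0 < d) (h : c.ofNat d = c.min) :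
    Nat.card α ≤ d := by
  have hs : Function.Surjective fun i : Fin d => c.ofNat i := by
    intro x
    obtain ⟨i, rfl⟩ := c.exists_ofNat_eq x
    refine ⟨⟨i % d, Nat.mod_lt _ hd⟩, ?_⟩
    have key : ∀ m r : ℕ, c.ofNat (r + d * m) = c.ofNat r := by
      intro m
      induction m with
      | zero => intro r; rfl
      | succ m ih => intro r; rw [Nat.mul_succ, ← Nat.add_assoc, c.ofNat_add_of_period h, ih]
    have := key (i / d) (i % d)
    rw [Nat.mod_add_div] at this
    exact this.symm
  simpa using Nat.card_le_card_of_surjective _ hs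

theorem ofNat_injOn [Finite α] {i j : ℕ} (hi : i < Nat.card α) (hj : j < Nat.card α)
    (h : c.ofNat i = c.ofNat j) : i = j := by
  wlog hij : i ≤ j generalizing i j
  · exact (this hj hi h.symm (by omega)).symm
  obtain ⟨d, rfl⟩ := Nat.exists_eq_add_of_le hij
  rcases Nat.eq_zero_or_pos d with rfl | hd
  · rfl
  · have := c.card_le_of_period hd (c.ofNat_add_eq i d h)
    omega

open Classical in
/-- The least number denoting a given value. -/
noncomputable def toNat [Finite α] (x : α) : ℕ := Nat.find (c.exists_ofNat_eq x)

theorem ofNat_toNat [Finite α] (x : α) : c.ofNat (c.toNat x) = x := by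
  classical exact Nat.find_spec (c.exists_ofNat_eq x)

theorem toNat_ofNat [Finite α] {i : ℕ} (hi : i < Nat.card α) : c.toNat (c.ofNat i) = i := by
  classical
  have hle : c.toNat (c.ofNat i) ≤ i := Nat.find_min' (c.exists_ofNat_eq _) rfl
  exact c.ofNat_injOn (by omega) hi (c.ofNat_toNat _)

end

/-- Transport along an equivalence. -/
def map {α β : Type} (c : Counter α) (e : α ≃ β) : Counter β where
  lt x y := c.lt (e.symm x) (e.symm y)
  inc x := e (c.inc (e.symm x))
  dec x := e (c.dec (e.symm x))
  min := e c.min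
  max := e c.max
  irrefl _ := c.irrefl _
  trans _ _ _ := c.trans _ _ _
  tri x y := by simpa using c.tri (e.symm x) (e.symm y)
  inc_dec x := by simp [c.inc_dec]
  dec_inc x := by simp [c.dec_inc]
  dec_min := by simp [c.dec_min]
  dec_lt x hx := by
    simp only [Equiv.symm_apply_apply]
    exact c.dec_lt _ fun h => hx (by rw [← h, Equiv.apply_symm_apply])
  not_lt_min x := by simpa using c.not_lt_min _

/-- The one-bit counter. -/
def bit : Counter Prop where
  lt a b := ¬ a ∧ b
  inc := Not
  dec := Not
  min := False
  max := True
  irrefl := by tauto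
  trans := by tauto
  tri a b := by by_cases a <;> by_cases b <;> simp_all
  inc_dec := by simp
  dec_inc := by simp
  dec_min := by simp
  dec_lt x hx := by simp_all
  not_lt_min := by simp

-- Numbers with digits in a counter

section Pi
variable {α β : Type} (r : α → α → Prop)

open Classical in
/-- Apply `s` to the digit at `x` unless a digit below differs from `e`. -/
noncomputable def step (e : β) (s : β → β) (f : α → β) (x : α) : β :=
  if ∃ y, r y x ∧ f y ≠ e then f x else s (f x)

/-- A step changes the digits up to and including the lowest one different from `e`. Those below it
turn from `e` into `e'`, and that one becomes different from `e'` by `he`. Hence the reverse step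
meets its first non-`e'` digit at the same position and touches the same digits. -/
theorem step_step (hr : WellFounded r) (trans : ∀ x y z, r x y → r y z → r x z)
    {e e' : β} {s s' : β → β} (hs : ∀ b, s' (s b) = b) (he : ∀ b, s b = e' ↔ b = e)
    (f : α → β) : step r e' s' (step r e s f) = f := by
  have key : ∀ x, (∃ y, r y x ∧ step r e s f y ≠ e') ↔ ∃ y, r y x ∧ f y ≠ e := by
    intro x
    constructor
    · rintro ⟨y, hy, h⟩
      by_contra! hc
      apply h
      have : ¬ ∃ z, r z y ∧ f z ≠ e := by
        rintro ⟨z, hz, hz'⟩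
        exact hz' (hc z (trans _ _ _ hz hy))
      rw [step, if_neg this, he]
      exact hc y hy
    · rintro ⟨y, hy, h⟩
      -- The position `y` itself may have been left unchanged by the step and hold `e'`; the lowest
      -- digit different from `e` is certainly changed, and not into `e'`.
      obtain ⟨m, ⟨hm, hme⟩, hmin⟩ := hr.has_min {y | r y x ∧ f y ≠ e} ⟨y, hy, h⟩
      refine ⟨m, hm, ?_⟩
      have : ¬ ∃ z, r z m ∧ f z ≠ e := by
        rintro ⟨z, hz, hz'⟩
        exact hmin z ⟨trans _ _ _ hz hm, hz'⟩ hz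
      rw [step, if_neg this, Ne, he]
      exact hme
  funext x
  rw [step]
  by_cases h : ∃ y, r y x ∧ f y ≠ e
  · rw [if_pos ((key x).2 h), step, if_pos h]
  · rw [if_neg (mt (key x).1 h), step, if_neg h, hs]

/-- The counter whose values are sequences of digits, the positions being ordered by `r` from the
least significant one upwards. -/
noncomputable def pi [Finite α] (irrefl : ∀ x, ¬ r x x) (trans : ∀ x y z, r x y → r y z → r x z)
    (tri : ∀ x y, x = y ∨ r x y ∨ r y x) (c : Counter β) : Counter (α → β) where
  lt f g := ∃ x, c.lt (f x) (g x) ∧ ∀ y, r x y → f y = g y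
  inc := step r c.max c.inc
  dec := step r c.min c.dec
  min := fun _ => c.min
  max := fun _ => c.max
  irrefl := fun f ⟨x, hx, _⟩ => c.irrefl _ hx
  trans := by
    rintro f g h ⟨x, hx, hx'⟩ ⟨y, hy, hy'⟩
    -- The more significant of the two deciding positions decides between `f` and `h`.
    rcases tri x y with rfl | hxy | hxy
    · exact ⟨x, c.trans _ _ _ hx hy, fun z hz => (hx' z hz).trans (hy' z hz)⟩
    · exact ⟨y, by rw [hx' y hxy]; exact hy,
        fun z hz => (hx' z (trans _ _ _ hxy hz)).trans (hy' z hz)⟩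
    · exact ⟨x, by rw [← hy' x hxy]; exact hx,
        fun z hz => (hx' z hz).trans (hy' z (trans _ _ _ hxy hz))⟩
  tri f g := by
    by_cases h : f = g
    · exact Or.inl h
    · right
      have hwf : WellFounded fun x y => r y x :=
        wellFounded_of_finite irrefl fun x y z h₁ h₂ => trans _ _ _ h₂ h₁
      obtain ⟨m, hm, hmax⟩ := hwf.has_min {x | f x ≠ g x} (Function.ne_iff.1 h)
      have hmax' : ∀ y, r m y → f y = g y := fun y hy => by
        by_contra hne
        exact hmax y hne hy
      rcases c.tri (f m) (g m) with h' | h' | h'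
      · exact absurd h' hm
      · exact Or.inl ⟨m, h', hmax'⟩
      · exact Or.inr ⟨m, h', fun y hy => (hmax' y hy).symm⟩
  inc_dec := step_step r (wellFounded_of_finite irrefl trans) trans c.inc_dec c.dec_eq_max_iff
  dec_inc := step_step r (wellFounded_of_finite irrefl trans) trans c.dec_inc c.inc_eq_min_iff
  dec_min := by
    funext x
    simp [step, c.dec_min]
  dec_lt f hf := by
    -- The lowest nonzero digit is the most significant one that changes: it decreases, and every
    -- digit above it is kept because `m` itself blocks the borrow.
    obtain ⟨m, hm, hmin⟩ := (wellFounded_of_finite irrefl trans).has_min {x | f x ≠ c.min}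
      (Function.ne_iff.1 hf)
    refine ⟨m, ?_, fun y hy => if_pos ⟨m, hy, hm⟩⟩
    have : ¬ ∃ z, r z m ∧ f z ≠ c.min := by
      rintro ⟨z, hz, hz'⟩
      exact hmin z hz' hz
    rw [step, if_neg this]
    exact c.dec_lt _ hm
  not_lt_min := fun f ⟨x, hx, _⟩ => c.not_lt_min _ hx

end Pi

end Counter

/-! ### The domains of the types `τ_k` -/

/-- A function as an element of a function domain with argument variance `0`. -/
def Dom.mk {S : Type} {σ τ : Ty} (f : Dom S σ → Dom S τ) : Dom S (.arr σ .zero τ) :=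
  letI := (Ty.lattice S σ).2
  letI := (Ty.lattice S τ).2
  letI := Variance.zero.preorder (Ty.lattice S σ).1
  show (Ty.lattice S σ).1 →o (Ty.lattice S τ).1 from
    -- At variance `0` the argument order is equality, so every function is monotone.
    ⟨f, fun a b h => (congrArg f (show a = b from le_antisymm h.1 h.2)).le⟩

@[simp]
theorem Dom.ap_mk {S : Type} {σ τ : Ty} (f : Dom S σ → Dom S τ) (x : Dom S σ) :
    Dom.ap (Dom.mk f) x = f x := rfl

theorem Dom.ap_injective {S : Type} {σ τ : Ty} {v : Variance} {f g : Dom S (.arr σ v τ)}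
    (h : ∀ x, Dom.ap f x = Dom.ap g x) : f = g :=
  letI := (Ty.lattice S σ).2
  letI := (Ty.lattice S τ).2
  letI := v.preorder (Ty.lattice S σ).1
  OrderHom.ext (α := (Ty.lattice S σ).1) (β := (Ty.lattice S τ).1) f g (funext h)

@[simp]
theorem Dom.mk_ap {S : Type} {σ τ : Ty} (f : Dom S (.arr σ .zero τ)) :
    Dom.mk (fun x => Dom.ap f x) = f := Dom.ap_injective fun _ => rfl

theorem Dom.pr_ext {S : Type} {x y : Dom S .pr}
    (h : ∀ s, s ∈ Dom.toSet x ↔ s ∈ Dom.toSet y) : x = y := Set.ext h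

theorem Dom.mem_ofSet {S : Type} {s : S} {p : S → Prop} :
    s ∈ Dom.toSet (Dom.ofSet {s | p s}) ↔ p s := Iff.rfl

/-- The domain of a function type with argument variance `0` consists of all functions. -/
def Dom.equivFun (S : Type) (σ τ : Ty) : (Dom S σ → Dom S τ) ≃ Dom S (.arr σ .zero τ) where
  toFun := Dom.mk
  invFun f x := Dom.ap f x
  left_inv _ := rfl
  right_inv := Dom.mk_ap

def Dom.equivPred (S : Type) : (S → Prop) ≃ Dom S .pr := Equiv.refl _

/-- The domain of `τ_k` over `N` states. -/
abbrev D (N k : ℕ) : Type := Dom (Fin N) (tau k)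

instance finite_D (N : ℕ) : (k : ℕ) → Finite (D N k)
  | 0 => Finite.of_equiv _ (Dom.equivPred (Fin N))
  | k + 1 =>
    haveI := finite_D N k
    haveI := finite_D N 0
    haveI : Finite (Dom (Fin N) .pr) := finite_D N 0
    Finite.of_equiv _ (Dom.equivFun (Fin N) (tau k) .pr)

theorem card_D (N k : ℕ) : Nat.card (D N k) = F k N := by
  have h0 : Nat.card (Dom (Fin N) .pr) = 2 ^ N := by
    rw [← Nat.card_congr (Dom.equivPred (Fin N)), Nat.card_fun]
    simp
  induction k with
  | zero => exact h0
  | succ k ih =>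
    rw [F, ← ih, pow_mul, ← h0, ← Nat.card_fun]
    exact (Nat.card_congr (Dom.equivFun (Fin N) (tau k) .pr)).symm

theorem le_F (k N : ℕ) : N ≤ F k N := by
  have h1 : ∀ m, 1 ≤ F m N := fun m => by cases m <;> exact Nat.one_le_two_pow
  cases k with
  | zero => exact Nat.lt_two_pow_self.le
  | succ k => exact (Nat.le_mul_of_pos_right N (h1 k)).trans Nat.lt_two_pow_self.le

/-- The counter on the sets of states, read as binary numbers with `N` digits. -/
noncomputable def setCounter (N : ℕ) : Counter (Dom (Fin N) .pr) :=
  (Counter.bit.pi (· < · : Fin N → Fin N → Prop) (fun _ => lt_irrefl _) (fun _ _ _ => lt_trans)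
    (fun x y => by rcases lt_trichotomy x y with h | h | h <;> simp [h])).map (Dom.equivPred _)

/-- The counter on the domain of `τ_k`. -/
noncomputable def counter (N : ℕ) : (k : ℕ) → Counter (D N k)
  | 0 => setCounter N
  | k + 1 =>
    ((setCounter N).pi (counter N k).lt (counter N k).irrefl (counter N k).trans
      (counter N k).tri).map (Dom.equivFun (Fin N) (tau k) .pr)

-- Arithmetic on the domains: membership, digits and small numbers

section
variable {N : ℕ}

/-- The right-hand side is the modal form of the carry rule, as used in `inc0`: a bit keeps its
value iff some lower bit is unset. -/
theorem mem_setCounter_inc (x : Dom (Fin N) .pr) (s : Fin N) :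
    s ∈ Dom.toSet ((setCounter N).inc x) ↔
      (s ∈ Dom.toSet x ↔ ∃ t, t < s ∧ t ∉ Dom.toSet x) := by
  change Counter.step _ _ _ (fun i => i ∈ Dom.toSet x) s ↔ _
  unfold Counter.step
  change @ite Prop (∃ y, y < s ∧ (y ∈ Dom.toSet x) ≠ True) (Classical.propDecidable _)
    (s ∈ Dom.toSet x) (¬ s ∈ Dom.toSet x) ↔ _
  split_ifs with h <;> simp only [ne_eq, eq_iff_iff, iff_true] at h
  · exact (iff_true_right h).symm
  · exact (iff_false_right h).symm

theorem mem_setCounter_dec (x : Dom (Fin N) .pr) (s : Fin N) :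
    s ∈ Dom.toSet ((setCounter N).dec x) ↔
      (s ∈ Dom.toSet x ↔ ∃ t, t < s ∧ t ∈ Dom.toSet x) := by
  change Counter.step _ _ _ (fun i => i ∈ Dom.toSet x) s ↔ _
  unfold Counter.step
  change @ite Prop (∃ y, y < s ∧ (y ∈ Dom.toSet x) ≠ False) (Classical.propDecidable _)
    (s ∈ Dom.toSet x) (¬ s ∈ Dom.toSet x) ↔ _
  split_ifs with h <;> simp only [ne_eq, eq_iff_iff, iff_false, not_not] at h
  · exact (iff_true_right h).symm
  · exact (iff_false_right h).symm

theorem setCounter_lt (x y : Dom (Fin N) .pr) :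
    (setCounter N).lt x y ↔ ∃ s, (s ∉ Dom.toSet x ∧ s ∈ Dom.toSet y) ∧
      ∀ t, s < t → (t ∈ Dom.toSet x ↔ t ∈ Dom.toSet y) := by
  change (∃ s, (s ∉ Dom.toSet x ∧ s ∈ Dom.toSet y) ∧
      ∀ t, s < t → (t ∈ Dom.toSet x) = (t ∈ Dom.toSet y)) ↔ _
  simp only [eq_iff_iff]

theorem not_mem_setCounter_min (s : Fin N) : s ∉ Dom.toSet (setCounter N).min := id

theorem mem_setCounter_max (s : Fin N) : s ∈ Dom.toSet (setCounter N).max := trivial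

theorem counter_succ_lt (k : ℕ) (f g : D N (k + 1)) :
    (counter N (k + 1)).lt f g ↔ ∃ x, (setCounter N).lt (Dom.ap f x) (Dom.ap g x) ∧
      ∀ y, (counter N k).lt x y → Dom.ap f y = Dom.ap g y := Iff.rfl

open Classical in
theorem ap_counter_succ_inc (k : ℕ) (f : D N (k + 1)) (x : D N k) :
    Dom.ap ((counter N (k + 1)).inc f) x =
      if ∃ y, (counter N k).lt y x ∧ Dom.ap f y ≠ (setCounter N).max then Dom.ap f x
      else (setCounter N).inc (Dom.ap f x) := rfl

theorem ap_counter_succ_min (k : ℕ) (x : D N k) :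
    Dom.ap (counter N (k + 1)).min x = (setCounter N).min := rfl

/-- The same carry rule for natural numbers. By halving: for even `i` only bit `0` changes, for odd
`i` bit `0` is set and the carry passes on to `i / 2`. -/
theorem testBit_add_one (j i : ℕ) : (i + 1).testBit j = true ↔
    (i.testBit j = true ↔ ∃ l, l < j ∧ i.testBit l = false) := by
  induction j generalizing i with
  | zero => simp [Nat.testBit_zero]; omega
  | succ j ih =>
    rw [Nat.testBit_succ, Nat.testBit_succ]
    rcases Nat.even_or_odd' i with ⟨m, rfl | rfl⟩
    · have h : ∃ l, l < j + 1 ∧ (2 * m).testBit l = false := ⟨0, by omega, by simp⟩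
      have h1 : (2 * m + 1) / 2 = m := by omega
      have h2 : 2 * m / 2 = m := by omega
      simp only [h, h1, h2, iff_true]
    · have h1 : (2 * m + 1 + 1) / 2 = m + 1 := by omega
      have h2 : (2 * m + 1) / 2 = m := by omega
      rw [h1, h2, ih]
      have h3 : (∃ l, l < j + 1 ∧ (2 * m + 1).testBit l = false) ↔
          ∃ l, l < j ∧ m.testBit l = false := by
        constructor
        · rintro ⟨l, hl, h⟩
          cases l with
          | zero => simp at h
          | succ l => exact ⟨l, by omega, by rwa [Nat.testBit_succ, h2] at h⟩
        · rintro ⟨l, hl, h⟩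
          exact ⟨l + 1, by omega, by rwa [Nat.testBit_succ, h2]⟩
      rw [h3]

theorem setCounter_ofNat (i : ℕ) (hi : i ≤ N) :
    (setCounter N).ofNat i = Dom.ofSet {s : Fin N | i.testBit s = true} := by
  induction i with
  | zero =>
    refine Dom.pr_ext fun s => iff_of_false (not_mem_setCounter_min s) ?_
    rw [Dom.mem_ofSet, Nat.zero_testBit]
    exact Bool.false_ne_true
  | succ i ih =>
    refine Dom.pr_ext fun s => ?_
    rw [Counter.ofNat_succ, ih (by omega), mem_setCounter_inc]
    simp only [Dom.mem_ofSet]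
    rw [testBit_add_one]
    apply iff_congr Iff.rfl
    constructor
    · rintro ⟨t, ht, h⟩
      exact ⟨t, ht, by simpa using h⟩
    · rintro ⟨l, hl, h⟩
      exact ⟨⟨l, hl.trans s.2⟩, hl, by simpa using h⟩

-- Counting up to `N` never overflows the lowest digit, which can count to `2 ^ N - 1`, so all other
-- digits stay at the minimum. This justifies `chi` at positive levels.
open Classical in
theorem ap_counter_succ_ofNat (k i : ℕ) (hi : i ≤ N) (x : D N k) :
    Dom.ap ((counter N (k + 1)).ofNat i) x =
      if x = (counter N k).min then (setCounter N).ofNat i else (setCounter N).min := by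
  induction i generalizing x with
  | zero => rw [Counter.ofNat_zero, Counter.ofNat_zero, ap_counter_succ_min, ite_self]
  | succ i ih =>
    have ih' := ih (by omega)
    rw [Counter.ofNat_succ, ap_counter_succ_inc]
    by_cases hx : x = (counter N k).min
    · rw [if_neg, ih', if_pos hx, if_pos hx, Counter.ofNat_succ]
      rintro ⟨y, hy, -⟩
      rw [hx] at hy
      exact (counter N k).not_lt_min y hy
    · rw [if_pos, ih', if_neg hx, if_neg hx]
      refine ⟨_, (counter N k).min_lt x hx, ?_⟩
      rw [ih', if_pos rfl, setCounter_ofNat i (by omega)]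
      intro h
      -- The lowest digit `i` is not the maximum: its bit number `i` exists because `i < N`, and is
      -- unset because `i < 2 ^ i`.
      have h' := mem_setCounter_max (⟨i, by omega⟩ : Fin N)
      rw [← h] at h'
      change i.testBit i = true at h'
      rw [Nat.testBit_lt_two_pow Nat.lt_two_pow_self] at h'
      exact absurd h' (by simp)

end

/-! ### Semantic rules -/

section Rules
variable {S P A V : Type} {T : LTS S P A} {φ ψ β : Fml P A V} {η : Env S V}

@[simp]
theorem Env.set_self (η : Env S V) (X : V) {τ : Ty} (x : Dom S τ) :
    η.set X x X = some ⟨τ, x⟩ := by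
  classical exact Function.update_self ..

theorem Env.set_of_ne (η : Env S V) {X Y : V} (h : Y ≠ X) {τ : Ty} (x : Dom S τ) :
    η.set X x Y = η Y := by
  classical exact Function.update_of_ne h ..

/-- `φ` denotes the element `x` of the domain of the type `τ`. -/
def Denotes (T : LTS S P A) (φ : Fml P A V) (η : Env S V) {τ : Ty} (x : Dom S τ) : Prop :=
  den T φ η = some ⟨τ, x⟩

/-- `φ` denotes the set of the states that satisfy `p`. -/
def Holds (T : LTS S P A) (φ : Fml P A V) (η : Env S V) (p : S → Prop) : Prop :=
  Denotes T φ η (Dom.ofSet {s | p s})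

theorem Holds.congr {p q : S → Prop} (h : Holds T φ η p) (hpq : ∀ s, p s ↔ q s) :
    Holds T φ η q := by
  rwa [show q = p from funext fun s => propext (hpq s).symm]

theorem Denotes.var_self {X : V} {τ : Ty} {x : Dom S τ} : Denotes T (.var X) (η.set X x) x :=
  Env.set_self ..

theorem Denotes.var_set {X Y : V} {σ τ : Ty} {x : Dom S τ} {y : Dom S σ} (h : Y ≠ X)
    (hY : Denotes T (.var Y) η y) : Denotes T (.var Y) (η.set X x) y :=
  (Env.set_of_ne η h x).trans hY

theorem Denotes.holds {x : Dom S .pr} (h : Denotes T φ η x) :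
    Holds T φ η fun s => s ∈ Dom.toSet x := h

/-- `den` selects a complement by choice; uniqueness identifies the selected one with the intended
one. -/
theorem IsNeg.unique : (τ : Ty) → {f f' g : Dom S τ} → IsNeg τ f g → IsNeg τ f' g → f = f'
  | .pr, _, _, _, h, h' => Eq.trans (α := Set S) h (Eq.symm h')
  | .arr _ _ τ, _, _, _, h, h' => Dom.ap_injective fun x => IsNeg.unique τ (h x) (h' x)

theorem Denotes.neg_of_isNeg {τ : Ty} {f g : Dom S τ} (h : Denotes T φ η g) (hn : IsNeg τ f g) :
    Denotes T (.neg φ) η f := by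
  have hex : ∃ f, IsNeg τ f g := ⟨f, hn⟩
  unfold Denotes at h ⊢
  simp only [den, h]
  rw [dif_pos hex, IsNeg.unique τ hex.choose_spec hn]

theorem Holds.neg {p : S → Prop} (h : Holds T φ η p) : Holds T (.neg φ) η fun s => ¬ p s :=
  Denotes.neg_of_isNeg h (show _ = _ from rfl)

theorem Denotes.neg_pred {σ : Ty} {g : Dom S (.arr σ .zero .pr)} (h : Denotes T φ η g) :
    Denotes T (.neg φ) η
      (Dom.mk fun x => Dom.ofSet {s | s ∉ Dom.toSet (Dom.ap g x)} : Dom S (.arr σ .zero .pr)) :=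
  Denotes.neg_of_isNeg h fun _ => rfl

theorem Holds.or {p q : S → Prop} (h₁ : Holds T φ η p) (h₂ : Holds T ψ η q) :
    Holds T (.or φ ψ) η fun s => p s ∨ q s := by
  unfold Holds Denotes at *
  simp only [den, h₁, h₂]
  rfl

theorem Holds.dia {a : A} {p : S → Prop} (h : Holds T φ η p) :
    Holds T (.dia a φ) η fun s => ∃ t, T.tr a s t ∧ p t := by
  unfold Holds Denotes at *
  simp only [den, h]
  rfl

theorem Denotes.app {σ τ : Ty} {u : Variance} {f : Dom S (.arr σ u τ)} {x : Dom S σ}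
    (h₁ : Denotes T φ η f) (h₂ : Denotes T ψ η x) : Denotes T (.app φ ψ) η (Dom.ap f x) := by
  unfold Denotes at *
  simp only [den, h₁, h₂, dite_true]

/-- The clause of `den` chooses both a result type and a function, so both have to be shown unique.
-/
theorem Denotes.lam {X : V} {σ τ : Ty} {f : Dom S σ → Dom S τ}
    (h : ∀ x : Dom S σ, Denotes T φ (η.set X x) (f x)) :
    Denotes T (.lam X .zero σ φ) η (Dom.mk f) := by
  have hex : ∃ (τ : Ty) (f : Dom S (.arr σ .zero τ)),
      ∀ x : Dom S σ, den T φ (η.set X x) = some ⟨τ, Dom.ap f x⟩ := ⟨τ, Dom.mk f, h⟩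
  have huniq : ∀ (τ' : Ty) (f' : Dom S (.arr σ .zero τ')),
      (∀ x : Dom S σ, den T φ (η.set X x) = some ⟨τ', Dom.ap f' x⟩) →
      (some ⟨.arr σ .zero τ', f'⟩ : Option (Val S)) = some ⟨.arr σ .zero τ, Dom.mk f⟩ := by
    intro τ' f' h'
    have key : ∀ x, (⟨τ', Dom.ap f' x⟩ : Val S) = ⟨τ, f x⟩ := fun x =>
      Option.some.inj ((h' x).symm.trans (h x))
    -- One argument suffices to compare the result types, and the domain, being a complete lattice,
    -- contains `⊥`.
    obtain rfl : τ' = τ := congrArg Sigma.fst (key ⊥)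
    have : f' = Dom.mk f := Dom.ap_injective fun x => eq_of_heq (Sigma.mk.inj (key x)).2
    rw [this]
  unfold Denotes
  simp only [den]
  rw [dif_pos hex]
  exact huniq _ _ hex.choose_spec.choose_spec

theorem Denotes.mu {X : V} {τ : Ty} {f : Dom S τ → Dom S τ}
    (h : ∀ x : Dom S τ, Denotes T φ (η.set X x) (f x)) :
    Denotes T (.mu X τ φ) η (sInf {x | f x ≤ x}) := by
  have hex : ∃ f : Dom S τ → Dom S τ, ∀ x : Dom S τ, den T φ (η.set X x) = some ⟨τ, f x⟩ :=
    ⟨f, h⟩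
  have huniq : hex.choose = f := funext fun x =>
    eq_of_heq (Sigma.mk.inj (Option.some.inj ((hex.choose_spec x).symm.trans (h x)))).2
  unfold Denotes
  simp only [den]
  rw [dif_pos hex, huniq]

theorem Holds.and {p q : S → Prop} (h₁ : Holds T φ η p) (h₂ : Holds T ψ η q) :
    Holds T (.and φ ψ) η fun s => p s ∧ q s :=
  (h₁.neg.or h₂.neg).neg.congr fun s => by tauto

theorem Holds.imp {p q : S → Prop} (h₁ : Holds T φ η p) (h₂ : Holds T ψ η q) :
    Holds T (.imp φ ψ) η fun s => p s → q s :=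
  (h₁.neg.or h₂).congr fun s => by tauto

theorem Holds.iff {p q : S → Prop} (h₁ : Holds T φ η p) (h₂ : Holds T ψ η q) :
    Holds T (.iff φ ψ) η fun s => p s ↔ q s :=
  ((h₁.imp h₂).and (h₂.imp h₁)).congr fun s => by tauto

theorem Holds.box {a : A} {p : S → Prop} (h : Holds T φ η p) :
    Holds T (.box a φ) η fun s => ∀ t, T.tr a s t → p t :=
  h.neg.dia.neg.congr fun s => by push Not; rfl

theorem Holds.ite {b p q : S → Prop} (h : Holds T β η b) (h₁ : Holds T φ η p)
    (h₂ : Holds T ψ η q) : Holds T (.ite β φ ψ) η fun s => (b s ∧ p s) ∨ (¬ b s ∧ q s) :=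
  (h.and h₁).or (h.neg.and h₂)

/-- The half of Knaster–Tarski that is needed here: the least fixpoint is only used as the least
prefixed point. -/
theorem sInf_prefixed_le_self {τ : Ty} {f : Dom S τ → Dom S τ} (hf : ∀ x y, x ≤ y → f x ≤ f y) :
    f (sInf {x | f x ≤ x}) ≤ sInf {x | f x ≤ x} :=
  le_sInf fun _ hx => (hf _ _ (sInf_le hx)).trans hx

end Rules

-- Denotations at level `0` and of the quantifiers

section Macros
variable {N : ℕ} {Q : Type} {η : Env (Fin N) (Vr Q)}

theorem holds_ff : Holds (sys N) (ff : Form Q) η fun _ => False := by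
  have h : Denotes (sys N) (ff : Form Q) η (sInf {x : Dom (Fin N) .pr | x ≤ x}) :=
    Denotes.mu (f := id) fun x => Denotes.var_self
  have h0 : sInf {x : Dom (Fin N) .pr | x ≤ x} = Dom.ofSet {_s | False} :=
    le_antisymm (sInf_le (le_refl (Dom.ofSet _))) fun s hs => hs.elim
  rwa [h0] at h

theorem holds_tt : Holds (sys N) (tt : Form Q) η fun _ => True :=
  holds_ff.neg.congr fun _ => not_false_iff

theorem holds_letter (a : Bool) : Holds (sys N) (letter a : Form Q) η fun _ => a = true := by
  cases a
  · exact holds_ff.congr fun _ => by simp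
  · exact holds_tt.congr fun _ => by simp

theorem holds_bigOr {ι : Type} {l : List ι} {f : ι → Form Q} {p : ι → Fin N → Prop}
    (h : ∀ i ∈ l, Holds (sys N) (f i) η (p i)) :
    Holds (sys N) (bigOr (l.map f)) η fun s => ∃ i ∈ l, p i s := by
  induction l with
  | nil => exact holds_ff.congr fun _ => by simp
  | cons i l ih =>
    exact ((h i (by simp)).or (ih fun j hj => h j (by simp [hj]))).congr fun _ => by simp

theorem holds_bigAnd {ι : Type} {l : List ι} {f : ι → Form Q} {p : ι → Fin N → Prop}
    (h : ∀ i ∈ l, Holds (sys N) (f i) η (p i)) :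
    Holds (sys N) (bigAnd (l.map f)) η fun s => ∀ i ∈ l, p i s := by
  induction l with
  | nil => exact holds_tt.congr fun _ => by simp
  | cons i l ih =>
    exact ((h i (by simp)).and (ih fun j hj => h j (by simp [hj]))).congr fun _ => by simp

/-- The diamond in `bit (i + 1)` places the state above `i`, and the box says that no state below it
exceeds `i`. -/
theorem holds_bit (i : ℕ) : Holds (sys N) (bit i : Form Q) η fun s => s.val = i := by
  induction i using Nat.strong_induction_on with
  | _ i ih =>
    cases i with
    | zero =>
      rw [bit]
      refine holds_ff.box.congr fun s => ⟨fun h => ?_, fun h t ht => ?_⟩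
      · by_contra hs
        exact h ⟨0, by omega⟩ (Fin.lt_def.2 (Nat.pos_of_ne_zero hs))
      · have := Fin.lt_def.1 (show t < s from ht)
        omega
    | succ i =>
      rw [bit]
      refine ((ih i (by omega)).dia.and
        (holds_bigOr fun j _ => ih j.1 (by omega)).box).congr fun s => ⟨?_, fun h => ⟨?_, ?_⟩⟩
      · rintro ⟨⟨t, ht, rfl⟩, h⟩
        have h1 := Fin.lt_def.1 (show t < s from ht)
        by_contra hs
        obtain ⟨j, -, hj⟩ := h ⟨t.val + 1, by omega⟩
          (show (_ : Fin N) < s from Fin.lt_def.2 (by simp only; omega))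
        have := j.2
        simp only at hj
        omega
      · exact ⟨⟨i, by omega⟩, show (_ : Fin N) < s from Fin.lt_def.2 (by simp only; omega), rfl⟩
      · intro t ht
        have h1 := Fin.lt_def.1 (show t < s from ht)
        exact ⟨⟨t.val, by omega⟩, List.mem_finRange _, rfl⟩

/-- A binary relation as an element of the domain of `σ^0 → τ^0 → Pr`. -/
def relDom {σ τ : Ty} (R : Dom (Fin N) σ → Dom (Fin N) τ → Prop) :
    Dom (Fin N) (.arr σ .zero (.arr τ .zero .pr)) :=
  Dom.mk fun x => Dom.mk fun y => Dom.ofSet {_s | R x y}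

theorem denotes_lam_lam {σ τ : Ty} {R : Dom (Fin N) σ → Dom (Fin N) τ → Prop} {x y : Vr Q}
    {φ : Form Q} (h : ∀ a b, Holds (sys N) φ ((η.set x a).set y b) fun _ => R a b) :
    Denotes (sys N) (lam x σ (lam y τ φ)) η (relDom R) :=
  Denotes.lam fun a => Denotes.lam fun b => h a b

theorem holds_app2 {σ τ : Ty} {R : Dom (Fin N) σ → Dom (Fin N) τ → Prop} {f φ ψ : Form Q}
    {a : Dom (Fin N) σ} {b : Dom (Fin N) τ} (hf : Denotes (sys N) f η (relDom R))
    (ha : Denotes (sys N) φ η a) (hb : Denotes (sys N) ψ η b) :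
    Holds (sys N) (app2 f φ ψ) η fun _ => R a b :=
  (hf.app ha).app hb

theorem denotes_inc0 : Denotes (sys N) (inc0 : Form Q) η (Dom.mk (setCounter N).inc) := by
  refine Denotes.lam fun x => ?_
  have hx : Holds (sys N) (v .X : Form Q) (η.set .X x) fun s => s ∈ Dom.toSet x :=
    Denotes.var_self
  exact (hx.iff hx.neg.dia).congr fun s => (mem_setCounter_inc x s).symm

theorem denotes_dec0 : Denotes (sys N) (dec0 : Form Q) η (Dom.mk (setCounter N).dec) := by
  refine Denotes.lam fun x => ?_
  have hx : Holds (sys N) (v .X : Form Q) (η.set .X x) fun s => s ∈ Dom.toSet x :=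
    Denotes.var_self
  exact (hx.iff hx.dia).congr fun s => (mem_setCounter_dec x s).symm

theorem denotes_eq0 : Denotes (sys N) (eq0 : Form Q) η
    (relDom (σ := .pr) (τ := .pr) fun x y => x = y) := by
  refine denotes_lam_lam fun x y => ?_
  have hx : Holds (sys N) (v .I : Form Q) ((η.set .I x).set .J y) fun s => s ∈ Dom.toSet x :=
    Denotes.var_set (by simp) Denotes.var_self
  have hy : Holds (sys N) (v .J : Form Q) ((η.set .I x).set .J y) fun s => s ∈ Dom.toSet y :=
    Denotes.var_self
  refine (hx.iff hy).box.congr fun s => ⟨fun h => Dom.pr_ext fun t => h t trivial, ?_⟩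
  rintro rfl t -
  rfl

theorem denotes_lt0 : Denotes (sys N) (lt0 N : Form Q) η (relDom (setCounter N).lt) := by
  refine denotes_lam_lam fun x y => ?_
  have hx : Holds (sys N) (v .I : Form Q) ((η.set .I x).set .J y) fun s => s ∈ Dom.toSet x :=
    Denotes.var_set (by simp) Denotes.var_self
  have hy : Holds (sys N) (v .J : Form Q) ((η.set .I x).set .J y) fun s => s ∈ Dom.toSet y :=
    Denotes.var_self
  refine (holds_bigOr fun k _ => (((holds_bit k).imp (hx.neg.and hy)).and
    (holds_bigAnd fun h _ => (holds_bit h).imp (hx.iff hy))).box).congr fun s => ?_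
  rw [setCounter_lt]
  constructor
  · rintro ⟨k, hk, h⟩
    have hk := List.mem_range.1 hk
    refine ⟨⟨k, hk⟩, (h ⟨k, hk⟩ trivial).1 rfl, fun t ht => (h t trivial).2 t.val ?_ rfl⟩
    exact List.mem_filter.2 ⟨List.mem_range.2 t.2, decide_eq_true ht⟩
  · rintro ⟨k, hk, h⟩
    refine ⟨k, List.mem_range.2 k.2, fun t _ => ⟨fun ht => ?_, fun l hl ht => h t ?_⟩⟩
    · rwa [Fin.ext ht]
    · have := (List.mem_filter.1 hl).2
      rw [Fin.lt_def, ht]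
      simpa using this

theorem denotes_minF (k : ℕ) : Denotes (sys N) (minF k : Form Q) η (counter N k).min := by
  cases k with
  | zero => exact holds_ff
  | succ k => exact Denotes.lam fun x => holds_ff

theorem denotes_max0 : Denotes (sys N) (max0 : Form Q) η (setCounter N).max :=
  holds_tt

/-- The fixpoint at `x` collects `p` along `x`, `inc x`, `inc (inc x)`, and so on; started at the
minimum this orbit is the whole domain. The quantification is separate for each state `s`. -/
theorem denotes_existsOf {k : ℕ} {inc : Form Q}
    (hinc : ∀ η, Denotes (sys N) inc η (Dom.mk (counter N k).inc)) :
    Denotes (sys N) (existsOf k inc) η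
      (Dom.mk fun p : D N (k + 1) => Dom.ofSet {s | ∃ x, s ∈ Dom.toSet (Dom.ap p x)}) := by
  refine Denotes.lam fun p => ?_
  let f : D N (k + 1) → D N (k + 1) := fun z => Dom.mk fun x =>
    Dom.ofSet {s | s ∈ Dom.toSet (Dom.ap p x) ∨
      s ∈ Dom.toSet (Dom.ap z ((counter N k).inc x))}
  have hf : ∀ z z', z ≤ z' → f z ≤ f z' := fun z z' h x s hs => hs.imp id fun hs => h _ hs
  have hmu := Denotes.app (T := sys N) (η := η.set .P p) (Denotes.mu (X := .Z) (f := f) fun z =>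
    Denotes.lam (X := Vr.X) fun x => Holds.or
      (((Denotes.var_set (y := p) (by simp) (Denotes.var_set (by simp) Denotes.var_self)).app
        (Denotes.var_self)).holds)
      (((Denotes.var_set (y := z) (by simp) Denotes.var_self).app
        ((hinc _).app (Denotes.var_self))).holds)) (denotes_minF k)
  refine Holds.congr (Denotes.holds hmu) fun s => ⟨fun hs => ?_, ?_⟩
  · let z : D N (k + 1) := Dom.mk fun _ => Dom.ofSet {s | ∃ x, s ∈ Dom.toSet (Dom.ap p x)}
    have hz : f z ≤ z := fun x s hs => hs.elim (fun h => ⟨x, h⟩) id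
    exact (sInf_le hz : sInf {x | f x ≤ x} ≤ z) _ hs
  · rintro ⟨x, hs⟩
    obtain ⟨i, rfl⟩ := (counter N k).exists_ofNat_eq x
    have hpre := sInf_prefixed_le_self hf
    -- Prefixedness carries membership from `inc x` back to `x`, hence from any iterate back to the
    -- minimum.
    have hi : ∀ i, s ∈ Dom.toSet (Dom.ap (sInf {x | f x ≤ x}) ((counter N k).ofNat i)) →
        s ∈ Dom.toSet (Dom.ap (sInf {x | f x ≤ x}) (counter N k).min) := by
      intro i
      induction i with
      | zero => exact id
      | succ i ih =>
        intro h
        rw [Counter.ofNat_succ] at h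
        exact ih (hpre ((counter N k).ofNat i) (Or.inr h))
    exact hi i (hpre ((counter N k).ofNat i) (Or.inl hs))

theorem holds_existsOf {k : ℕ} {inc φ : Form Q} {x : Vr Q} {p : D N k → Fin N → Prop}
    (hinc : ∀ η, Denotes (sys N) inc η (Dom.mk (counter N k).inc))
    (h : ∀ a, Holds (sys N) φ (η.set x a) (p a)) :
    Holds (sys N) (.app (existsOf k inc) (lam x (tau k) φ)) η fun s => ∃ a, p a s :=
  (denotes_existsOf hinc).app (Denotes.lam (σ := tau k) (τ := .pr) h)

theorem holds_forallOf {k : ℕ} {inc φ : Form Q} {x : Vr Q} {p : D N k → Fin N → Prop}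
    (hinc : ∀ η, Denotes (sys N) inc η (Dom.mk (counter N k).inc))
    (h : ∀ a, Holds (sys N) φ (η.set x a) (p a)) :
    Holds (sys N) (.app (forallOf k inc) (lam x (tau k) φ)) η fun s => ∀ a, p a s := by
  have hall : Denotes (sys N) (forallOf k inc) η
      (Dom.mk fun q : D N (k + 1) => Dom.ofSet {s | ∀ x, s ∈ Dom.toSet (Dom.ap q x)}) := by
    refine Denotes.lam fun q => ?_
    have hq : Denotes (sys N) (v .P : Form Q) (η.set .P q) q := Denotes.var_self
    refine (((denotes_existsOf hinc).app (Denotes.neg_pred hq)).holds.neg).congr fun s => ?_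
    exact not_exists_not
  exact hall.app (Denotes.lam (σ := tau k) (τ := .pr) h)

end Macros

-- Denotations at higher levels, of the tape and of the head

section Macros
variable {N : ℕ} {Q : Type} {η : Env (Fin N) (Vr Q)}

theorem denotes_gtOf {k : ℕ} {lt : Form Q}
    (hlt : ∀ η, Denotes (sys N) lt η (relDom (counter N k).lt)) :
    Denotes (sys N) (gtOf k lt) η (relDom fun x y : D N k => (counter N k).lt y x) :=
  denotes_lam_lam fun _ _ =>
    holds_app2 (hlt _) Denotes.var_self (Denotes.var_set (by simp) Denotes.var_self)

theorem Denotes.ap {k : ℕ} {φ ψ : Form Q} {f : D N (k + 1)} {x : D N k}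
    (h₁ : Denotes (sys N) φ η f) (h₂ : Denotes (sys N) ψ η x) :
    Denotes (sys N) (.app φ ψ) η (Dom.ap f x) :=
  Denotes.app h₁ h₂

/-- The condition `c` is the same in all states, so the union of the two guarded branches is one
whole branch. -/
theorem Holds.denotes_ite {φ : Form Q} {c : Prop} [Decidable c] {x y : Dom (Fin N) .pr}
    (h : Holds (sys N) φ η fun s => (c ∧ s ∈ Dom.toSet x) ∨ (¬ c ∧ s ∈ Dom.toSet y)) :
    Denotes (sys N) φ η (if c then x else y) := by
  split_ifs with hc
  · exact show Holds _ _ _ fun s => s ∈ Dom.toSet x from h.congr fun s => by simp [hc]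
  · exact show Holds _ _ _ fun s => s ∈ Dom.toSet y from h.congr fun s => by simp [hc]

open Classical in
theorem denotes_stepOf {k : ℕ} {inc lt e s : Form Q} {a : Dom (Fin N) .pr}
    {f : Dom (Fin N) .pr → Dom (Fin N) .pr}
    (hinc : ∀ η, Denotes (sys N) inc η (Dom.mk (counter N k).inc))
    (hlt : ∀ η, Denotes (sys N) lt η (relDom (counter N k).lt))
    (he : ∀ η, Denotes (sys N) e η a) (hs : ∀ η, Denotes (sys N) s η (Dom.mk f)) :
    Denotes (sys N) (stepOf k inc lt e s) η
      (Dom.mk fun g : D N (k + 1) => (Dom.mk fun x : D N k =>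
        if ∃ y, (counter N k).lt y x ∧ Dom.ap g y ≠ a then Dom.ap g x else f (Dom.ap g x) :
          D N (k + 1))) := by
  refine Denotes.lam fun g => Denotes.lam fun x => ?_
  have hg : Denotes (sys N) (v .I : Form Q) ((η.set .I g).set .X x) g :=
    Denotes.var_set (by simp) Denotes.var_self
  have hx : Denotes (sys N) (v .X : Form Q) ((η.set .I g).set .X x) x := Denotes.var_self
  have h := (holds_existsOf (x := Vr.Y) hinc fun y =>
    (holds_app2 (hlt _) Denotes.var_self (hx.var_set (by simp))).and
      (holds_app2 denotes_eq0 (Denotes.ap (hg.var_set (by simp)) Denotes.var_self)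
        (he _)).neg).ite (hg.ap hx).holds ((hs _).app (hg.ap hx)).holds
  exact h.denotes_ite

/-- Both are proved in one induction, since each of them at level `k + 1` uses both at level `k`:
`inc` drives the quantifiers and `lt` compares digit positions. -/
theorem denotes_inc_lt (k : ℕ) :
    (∀ η, Denotes (sys N) (inc N k : Form Q) η (Dom.mk (counter N k).inc)) ∧
      ∀ η, Denotes (sys N) (lt N k : Form Q) η (relDom (counter N k).lt) := by
  induction k with
  | zero =>
    refine ⟨fun η => ?_, fun η => ?_⟩
    · rw [inc]; exact denotes_inc0
    · rw [lt]; exact denotes_lt0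
  | succ k ih =>
    refine ⟨fun η => ?_, fun η => ?_⟩
    · rw [inc]
      exact denotes_stepOf ih.1 ih.2 (fun _ => denotes_max0) fun _ => denotes_inc0
    · rw [lt]
      refine denotes_lam_lam fun f g => ?_
      have hf : Denotes (sys N) (v .I : Form Q) ((η.set .I f).set .J g) f :=
        Denotes.var_set (by simp) Denotes.var_self
      have hg : Denotes (sys N) (v .J : Form Q) ((η.set .I f).set .J g) g := Denotes.var_self
      refine (holds_existsOf ih.1 fun x => (holds_app2 denotes_lt0
        (Denotes.ap (hf.var_set (by simp)) Denotes.var_self)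
        (Denotes.ap (hg.var_set (by simp)) Denotes.var_self)).and
        (holds_forallOf ih.1 fun y => (holds_app2 (denotes_gtOf ih.2) Denotes.var_self
          (Denotes.var_set (by simp) Denotes.var_self)).imp
          (holds_app2 denotes_eq0
            (Denotes.ap ((hf.var_set (by simp)).var_set (by simp)) Denotes.var_self)
            (Denotes.ap ((hg.var_set (by simp)).var_set (by simp)) Denotes.var_self)))).congr
        fun s => ?_
      exact (counter_succ_lt k f g).symm

theorem denotes_inc (k : ℕ) :
    Denotes (sys N) (inc N k : Form Q) η (Dom.mk (counter N k).inc) := (denotes_inc_lt k).1 η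

theorem denotes_lt (k : ℕ) :
    Denotes (sys N) (lt N k : Form Q) η (relDom (counter N k).lt) := (denotes_inc_lt k).2 η

theorem denotes_dec (k : ℕ) :
    Denotes (sys N) (dec N k : Form Q) η (Dom.mk (counter N k).dec) := by
  cases k with
  | zero => exact denotes_dec0
  | succ k =>
    exact denotes_stepOf (fun _ => denotes_inc k) (fun _ => denotes_lt k) (fun _ => holds_ff)
      fun _ => denotes_dec0

theorem denotes_eq (k : ℕ) :
    Denotes (sys N) (eq N k : Form Q) η (relDom fun x y : D N k => x = y) := by
  cases k with
  | zero => exact denotes_eq0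
  | succ k =>
    refine denotes_lam_lam fun f g => ?_
    have hf : Denotes (sys N) (v .I : Form Q) ((η.set .I f).set .J g) f :=
      Denotes.var_set (by simp) Denotes.var_self
    have hg : Denotes (sys N) (v .J : Form Q) ((η.set .I f).set .J g) g := Denotes.var_self
    refine (holds_forallOf (fun _ => denotes_inc k) fun x => holds_app2 denotes_eq0
      (Denotes.ap (hf.var_set (by simp)) Denotes.var_self)
      (Denotes.ap (hg.var_set (by simp)) Denotes.var_self)).congr fun s => ?_
    exact ⟨Dom.ap_injective, fun h x => by rw [h]⟩

theorem denotes_caseOf {ι : Type} (k : ℕ) (l : List ι) (α ψ : ι → Form Q) (a : ι → D N k)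
    (p : ι → Fin N → Prop) (hα : ∀ i ∈ l, ∀ η, Denotes (sys N) (α i) η (a i))
    (hψ : ∀ i ∈ l, ∀ η, Holds (sys N) (ψ i) η (p i)) :
    Denotes (sys N) (caseOf N k (l.map fun i => (α i, ψ i)) ff) η
      (Dom.mk fun x : D N k => Dom.ofSet {s | ∃ i ∈ l, x = a i ∧ p i s}) := by
  refine Denotes.lam fun x => ?_
  simp only [List.map_map]
  refine ((holds_bigOr fun i hi => (holds_app2 (denotes_eq k) Denotes.var_self (hα i hi _)).and
    (hψ i hi _)).or (holds_ff.and (holds_bigAnd fun i hi =>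
      (holds_app2 (denotes_eq k) Denotes.var_self (hα i hi _)).neg.or
        (hψ i hi _).neg))).congr fun s => ?_
  exact ⟨fun h => h.elim id fun h => h.1.elim, Or.inl⟩

theorem denotes_chi0 {i : ℕ} (hi : i ≤ N) :
    Denotes (sys N) (chi0 N i : Form Q) η ((setCounter N).ofNat i) := by
  rw [setCounter_ofNat i hi]
  refine (holds_bigOr fun j _ => holds_bit j).congr fun s => ?_
  constructor
  · rintro ⟨j, hj, rfl⟩
    exact (List.mem_filter.1 hj).2
  · intro h
    exact ⟨s.val, List.mem_filter.2 ⟨List.mem_range.2 s.2, h⟩, rfl⟩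

theorem denotes_chi (k : ℕ) {i : ℕ} (hi : i ≤ N) :
    Denotes (sys N) (chi N k i : Form Q) η ((counter N k).ofNat i) := by
  cases k with
  | zero => exact denotes_chi0 hi
  | succ k =>
    have h := denotes_caseOf (N := N) (Q := Q) (η := η) k [()] (fun _ => minF k)
      (fun _ => chi0 N i) (fun _ => (counter N k).min)
      (fun _ s => s ∈ Dom.toSet ((setCounter N).ofNat i)) (fun _ _ _ => denotes_minF k)
      fun _ _ _ => denotes_chi0 hi
    have he : (counter N (k + 1)).ofNat i = Dom.mk fun x : D N k => Dom.ofSet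
        {s | ∃ j ∈ [()], x = (counter N k).min ∧ s ∈ Dom.toSet ((setCounter N).ofNat i)} := by
      refine Dom.ap_injective fun x => ?_
      rw [ap_counter_succ_ofNat k i hi, Dom.ap_mk]
      refine Dom.pr_ext fun s => ?_
      rw [Dom.mem_ofSet]
      split_ifs with hx
      · simp [hx]
      · simp [hx, not_mem_setCounter_min]
    rw [he]
    exact h

/-- The encoding of a tape content. -/
noncomputable def tapeDom (N k : ℕ) (t : ℤ → Bool) : D N (k + 1) :=
  Dom.mk fun x : D N k => Dom.ofSet {_s | t ((counter N k).toNat x) = true}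

theorem denotes_tape0 (k : ℕ) (w : List Bool) (hw : w.length ≤ N) :
    Denotes (sys N) (tape0 N k w : Form Q) η
      (tapeDom N k fun i => if 0 ≤ i then w.getD i.toNat false else false) := by
  have h := denotes_caseOf (N := N) (Q := Q) (η := η) k w.zipIdx (fun y => chi N k y.2)
    (fun y => letter y.1) (fun y => (counter N k).ofNat y.2) (fun y _ => y.1 = true)
    (fun y hy η => denotes_chi k (by
      have := List.snd_lt_of_mem_zipIdx hy
      omega)) fun y _ η => holds_letter y.1
  have he : (tapeDom N k fun i => if 0 ≤ i then w.getD i.toNat false else false) =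
      Dom.mk fun x : D N k => Dom.ofSet
        {_s | ∃ y ∈ w.zipIdx, x = (counter N k).ofNat y.2 ∧ y.1 = true} := by
    refine Dom.ap_injective fun x => Dom.pr_ext fun s => ?_
    change (if (0 : ℤ) ≤ ((counter N k).toNat x : ℤ) then _ else _) = true ↔
      ∃ y ∈ w.zipIdx, x = (counter N k).ofNat y.2 ∧ y.1 = true
    rw [if_pos (Int.natCast_nonneg _), Int.toNat_natCast]
    constructor
    · intro h
      refine ⟨(true, (counter N k).toNat x), ?_, ((counter N k).ofNat_toNat x).symm, rfl⟩
      rw [List.mk_mem_zipIdx_iff_getElem?]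
      rw [List.getD_eq_getElem?_getD] at h
      cases h' : w[(counter N k).toNat x]? with
      | none => simp [h'] at h
      | some b => simpa [h'] using h
    · rintro ⟨⟨b, i⟩, hy, rfl, hb⟩
      -- Input positions are below `N`, and `N ≤ F k N`, so distinct positions denote distinct
      -- addresses.
      have hi : i < Nat.card (D N k) := by
        rw [card_D]
        have := List.snd_lt_of_mem_zipIdx hy
        exact lt_of_lt_of_le (by omega) (le_F k N)
      rw [List.mk_mem_zipIdx_iff_getElem?] at hy
      simp only at hb
      rw [Counter.toNat_ofNat _ hi, List.getD_eq_getElem?_getD, hy, hb]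
      rfl
  rw [he]
  exact h

theorem holds_read {k : ℕ} (a : Bool) {φ ψ : Form Q} {t : D N (k + 1)} {x : D N k}
    (ht : Denotes (sys N) φ η t) (hx : Denotes (sys N) ψ η x) :
    Holds (sys N) (app2 (read k a) φ ψ) η
      fun s => s ∈ Dom.toSet (Dom.ap t x) ↔ a = true := by
  have h : ∀ η, Denotes (sys N) (read k a : Form Q) η
      (Dom.mk fun t : D N (k + 1) => Dom.mk fun x : D N k =>
        Dom.ofSet {s | s ∈ Dom.toSet (Dom.ap t x) ↔ a = true}) := by
    intro η
    refine Denotes.lam fun t => Denotes.lam fun x => ?_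
    have hap := (Denotes.ap (N := N) (η := (η.set .T t).set .H x)
      (Denotes.var_set (by simp) Denotes.var_self) (Denotes.var_self (X := Vr.H (Q := Q)))).holds
    cases a
    · exact hap.neg.congr fun s => by simp
    · exact hap.congr fun s => by simp
  exact ((h η).app ht).app hx

/-- The tape content after writing the letter `a` at the position `x`. -/
def writeDom {k : ℕ} (a : Bool) (t : D N (k + 1)) (x : D N k) : D N (k + 1) :=
  Dom.mk fun y : D N k => Dom.ofSet
    {s | (x = y ∧ a = true) ∨ (x ≠ y ∧ s ∈ Dom.toSet (Dom.ap t y))}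

theorem denotes_write {k : ℕ} (a : Bool) {φ ψ : Form Q} {t : D N (k + 1)} {x : D N k}
    (ht : Denotes (sys N) φ η t) (hx : Denotes (sys N) ψ η x) :
    Denotes (sys N) (app2 (write N k a) φ ψ) η (writeDom a t x) := by
  have h : Denotes (sys N) (write N k a : Form Q) η
      (Dom.mk fun t : D N (k + 1) => Dom.mk fun x : D N k => writeDom a t x) := by
    refine Denotes.lam fun t => Denotes.lam fun x => Denotes.lam fun y => ?_
    exact (holds_app2 (denotes_eq k) (Denotes.var_set (by simp) Denotes.var_self)
      Denotes.var_self).ite (holds_letter a) (Denotes.ap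
        (Denotes.var_set (by simp) (Denotes.var_set (by simp) Denotes.var_self))
        Denotes.var_self).holds
  exact (h.app ht).app hx

/-- Head movements on the domain of `τ_k`. -/
noncomputable def moveDom (N k : ℕ) : Dir → D N k → D N k
  | .left => (counter N k).dec
  | .stay => id
  | .right => (counter N k).inc

theorem denotes_move {k : ℕ} (d : Dir) :
    Denotes (sys N) (move N k d : Form Q) η (Dom.mk (moveDom N k d)) := by
  cases d with
  | left => exact denotes_dec k
  | stay => exact Denotes.lam fun x => Denotes.var_self
  | right => exact denotes_inc k

/-- The encoding keeps only the cells `0, …, F k N - 1`. The bounds on `h` make its address stand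
for cell `h` and no other. -/
theorem tapeDom_update {k : ℕ} {t : ℤ → Bool} {h : ℤ} (h0 : 0 ≤ h) (h1 : h < F k N) (b : Bool) :
    writeDom b (tapeDom N k t) ((counter N k).ofNat h.toNat) =
      tapeDom N k (Function.update t h b) := by
  have hi : h.toNat < Nat.card (D N k) := by rw [card_D]; omega
  refine Dom.ap_injective fun x => Dom.pr_ext fun s => ?_
  change (((counter N k).ofNat h.toNat = x ∧ b = true) ∨ ((counter N k).ofNat h.toNat ≠ x ∧
    t ((counter N k).toNat x) = true)) ↔ Function.update t h b ((counter N k).toNat x) = true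
  by_cases hx : (counter N k).ofNat h.toNat = x
  · subst hx
    rw [Counter.toNat_ofNat _ hi, Int.toNat_of_nonneg h0]
    simp
  · have : ((counter N k).toNat x : ℤ) ≠ h := by
      intro he
      apply hx
      rw [← he, Int.toNat_natCast, Counter.ofNat_toNat]
    simp [hx, Function.update_of_ne this]

/-- The second hypothesis excludes a left move from cell `0`, which would wrap around to the
maximum. Right moves need no bound, as `ofNat` is defined on all numbers. -/
theorem moveDom_ofNat {k : ℕ} {h : ℤ} (d : Dir) (h0 : 0 ≤ h) (h1 : 0 ≤ h + d.toInt) :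
    moveDom N k d ((counter N k).ofNat h.toNat) =
      (counter N k).ofNat (h + d.toInt).toNat := by
  obtain ⟨n, rfl⟩ := Int.eq_ofNat_of_zero_le h0
  cases d with
  | left =>
    obtain ⟨m, rfl⟩ : ∃ m, n = m + 1 := ⟨n - 1, by simp only [Dir.toInt] at h1; omega⟩
    have : (((m + 1 : ℕ) : ℤ) + Dir.left.toInt).toNat = m := by simp [Dir.toInt]
    rw [this]
    exact (counter N k).dec_ofNat_succ m
  | stay => simp [Dir.toInt, moveDom]
  | right =>
    have : ((n : ℤ) + Dir.right.toInt).toNat = n + 1 := by simp [Dir.toInt]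
    rw [this]
    exact ((counter N k).ofNat_succ n).symm

end Macros

/-! ### Simultaneous least fixpoints -/

section Simultaneous
variable {Q : Type} [DecidableEq Q] {L : Type} [CompleteLattice L]

/-- The component `q` of a simultaneous least fixpoint, computed by nested least fixpoints; the
components in `B` are given by `b`. -/
noncomputable def simSol [Fintype Q] (R : Q → (Q → L) → L) (B : Finset Q) (b : Q → L) (q : Q) : L :=
  if _h : q ∈ B then b q
  else sInf {x | R q (fun q' => simSol R (insert q B) (Function.update b q x) q') ≤ x}
termination_by Bᶜ.card
decreasing_by
  apply Finset.card_lt_card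
  rw [Finset.compl_ssubset_compl]
  exact Finset.ssubset_insert _h

variable [Fintype Q] {R : Q → (Q → L) → L} {B : Finset Q} {b : Q → L}

theorem simSol_of_mem {q : Q} (h : q ∈ B) : simSol R B b q = b q := by
  rw [simSol, dif_pos h]

theorem simSol_of_notMem {q : Q} (h : q ∉ B) : simSol R B b q =
    sInf {x | R q (simSol R (insert q B) (Function.update b q x)) ≤ x} := by
  rw [simSol, dif_neg h]

/-- Induction along the recursion of `simMu` and `simSol`, in which the set of bound components
grows. -/
theorem compl_insert_induction {motive : Finset Q → Prop}
    (step : ∀ B, (∀ q, q ∉ B → motive (insert q B)) → motive B) (B : Finset Q) : motive B := by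
  induction h : Bᶜ.card using Nat.strong_induction_on generalizing B with
  | _ n ih =>
    refine step B fun q hq => ih _ ?_ _ rfl
    rw [← h]
    apply Finset.card_lt_card
    rw [Finset.compl_ssubset_compl]
    exact Finset.ssubset_insert hq

variable (hR : ∀ q g g', g ≤ g' → R q g ≤ R q g')
include hR

theorem simSol_le {g : Q → L} (hb : ∀ q ∈ B, b q ≤ g q) (hg : ∀ q, q ∉ B → R q g ≤ g q) :
    simSol R B b ≤ g := by
  induction B using compl_insert_induction generalizing b with
  | step B ih =>
    intro q
    by_cases hq : q ∈ B
    · rw [simSol_of_mem hq]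
      exact hb q hq
    · rw [simSol_of_notMem hq]
      refine sInf_le ((hR q _ _ (ih q hq ?_ ?_)).trans (hg q hq))
      · intro q' hq'
        by_cases h : q' = q
        · subst h; simp
        · rw [Function.update_of_ne h]
          exact hb q' (Finset.mem_of_mem_insert_of_ne hq' h)
      · exact fun q' hq' => hg q' fun h => hq' (Finset.mem_insert_of_mem h)

/-- Bekić's principle. Fixing component `q` at its own solution turns the remaining inner solution
into a prefixed vector of the whole system outside `B`; by `simSol_le` it dominates `simSol R B b`,
and monotonicity of the row transfers the inequality. -/
theorem row_simSol_le {q : Q} (hq : q ∉ B) :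
    R q (simSol R B b) ≤ simSol R B b q := by
  induction B using compl_insert_induction generalizing b q with
  | step B ih =>
    have hmono : ∀ x y, x ≤ y → R q (simSol R (insert q B) (Function.update b q x)) ≤
        R q (simSol R (insert q B) (Function.update b q y)) := by
      intro x y hxy
      -- The inner solution is monotone in the value fixed at `q`: the one for `y` is prefixed by
      -- induction, so the one for `x` lies below it by leastness.
      refine hR q _ _ (simSol_le hR (fun q' hq' => ?_) fun q' hq' => ih q hq hq')
      rw [simSol_of_mem hq']
      by_cases h : q' = q
      · subst h; simpa using hxy
      · simp [Function.update_of_ne h]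
    have hfix : R q (simSol R (insert q B) (Function.update b q (simSol R B b q))) ≤
        simSol R B b q := by
      conv_rhs => rw [simSol_of_notMem hq]
      refine le_sInf fun x hx => (hmono _ _ ?_).trans hx
      rw [simSol_of_notMem hq]
      exact sInf_le hx
    -- The inner solution is prefixed outside `B`: at `q` by `hfix`, elsewhere by induction.
    refine (hR q _ _ (simSol_le hR (fun q' hq' => ?_) fun q' hq' => ?_)).trans hfix
    · have hne : q' ≠ q := fun h => hq (h ▸ hq')
      rw [simSol_of_mem (Finset.mem_insert_of_mem hq'), Function.update_of_ne hne]
    · by_cases h : q' = q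
      · subst h
        rw [simSol_of_mem (Finset.mem_insert_self ..), Function.update_self]
        exact hfix
      · exact ih q hq (by simp [h, hq'])

end Simultaneous

section Sim
variable {Q : Type} [Fintype Q] [DecidableEq Q] {N : ℕ}

/-- `hrows` lets the environment of `r q'` differ from `η` outside the state variables, because a
row places `r q'` below its binders for the tape and the head. -/
theorem denotes_simMu {τ : Ty} {rows : Q → (Q → Form Q) → Form Q}
    {R : Q → (Q → Dom (Fin N) τ) → Dom (Fin N) τ}
    (hrows : ∀ q r η g, (∀ η' : Env (Fin N) (Vr Q), (∀ q, η' (.st q) = η (.st q)) →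
      ∀ q', Denotes (sys N) (r q') η' (g q')) → Denotes (sys N) (rows q r) η (R q g))
    {B : Finset Q} {b : Q → Dom (Fin N) τ} {η : Env (Fin N) (Vr Q)}
    (hη : ∀ q ∈ B, η (.st q) = some ⟨τ, b q⟩) (q : Q) :
    Denotes (sys N) (simMu τ rows B q) η (simSol R B b q) := by
  induction B using compl_insert_induction generalizing b η q with
  | step B ih =>
    rw [simMu]
    by_cases hq : q ∈ B
    · rw [dif_pos hq, simSol_of_mem hq]
      exact hη q hq
    · rw [dif_neg hq, simSol_of_notMem hq]
      refine Denotes.mu fun x => hrows _ _ _ _ fun η' hη' q' => ih q hq ?_ q'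
      intro q'' hq''
      rw [hη']
      by_cases h : q'' = q
      · subst h; simp
      · rw [Env.set_of_ne _ (by simpa using h), Function.update_of_ne h]
        exact hη q'' (Finset.mem_of_mem_insert_of_ne hq'' h)

end Sim

/-! ### The simulation of the machine -/

section Machine
variable {Q : Type} {N k : ℕ} {M : ATM Q}

/-- Application of an element of the domain of `τ_{k+1}^0 → τ_k^0 → Pr` to its arguments. -/
def apSt (g : Dom (Fin N) (stTy k)) (t : D N (k + 1)) (x : D N k) : Dom (Fin N) .pr :=
  Dom.ap (Dom.ap g t) x

theorem stTy_le_iff (g g' : Dom (Fin N) (stTy k)) : g ≤ g' ↔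
    ∀ t x s, s ∈ Dom.toSet (apSt g t x) → s ∈ Dom.toSet (apSt g' t x) := Iff.rfl

/-- The successors of a configuration with tape `t` and head position `x`, as sets of states. -/
def succDom (g : Q → Dom (Fin N) (stTy k)) (t : D N (k + 1)) (x : D N k)
    (e : Q × Bool × Q × Bool × Dir) : Dom (Fin N) .pr :=
  apSt (g e.2.2.1) (writeDom e.2.2.2.1 t x) (moveDom N k e.2.2.2.2 x)

/-- The semantics of the equation for the state `q`. -/
def rowDom (M : ATM Q) (q : Q) (g : Q → Dom (Fin N) (stTy k)) : Dom (Fin N) (stTy k) :=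
  Dom.mk fun t : D N (k + 1) => Dom.mk fun x : D N k => Dom.ofSet {s |
    match M.kind q with
    | .acc => True
    | .rej => False
    | .exist => ∃ a : Bool, (s ∈ Dom.toSet (Dom.ap t x) ↔ a = true) ∧
        ∃ e ∈ M.delta, (e.1 = q ∧ e.2.1 = a) ∧ s ∈ Dom.toSet (succDom g t x e)
    | .univ => ∃ a : Bool, (s ∈ Dom.toSet (Dom.ap t x) ↔ a = true) ∧
        ∀ e ∈ M.delta, (e.1 = q ∧ e.2.1 = a) → s ∈ Dom.toSet (succDom g t x e)}

theorem rowDom_mono (q : Q) (g g' : Q → Dom (Fin N) (stTy k)) (h : g ≤ g') :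
    rowDom M q g ≤ rowDom M q g' := by
  have h' : ∀ t x e s, s ∈ Dom.toSet (succDom g t x e) →
      s ∈ Dom.toSet (succDom g' t x e) := fun t x e s => (stTy_le_iff _ _).1 (h e.2.2.1) _ _ _
  rw [stTy_le_iff]
  intro t x s
  change (match M.kind q with | .acc => _ | .rej => _ | .exist => _ | .univ => _) →
    (match M.kind q with | .acc => _ | .rej => _ | .exist => _ | .univ => _)
  cases M.kind q with
  | acc => exact id
  | rej => exact id
  | exist =>
    rintro ⟨a, ha, e, he, he', hs⟩
    exact ⟨a, ha, e, he, he', h' _ _ _ _ hs⟩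
  | univ =>
    rintro ⟨a, ha, hs⟩
    exact ⟨a, ha, fun e he he' => h' _ _ _ _ (hs e he he')⟩

theorem denotes_row [DecidableEq Q] (q : Q) (r : Q → Form Q) (η : Env (Fin N) (Vr Q))
    (g : Q → Dom (Fin N) (stTy k))
    (hr : ∀ η' : Env (Fin N) (Vr Q), (∀ q, η' (.st q) = η (.st q)) →
      ∀ q', Denotes (sys N) (r q') η' (g q')) :
    Denotes (sys N) (row N k M q r) η (rowDom M q g) := by
  refine Denotes.lam fun t => Denotes.lam fun x => ?_
  have hη : ∀ q, ((η.set .T t).set .H x) (.st q) = η (.st q) := fun q => by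
    rw [Env.set_of_ne _ (by simp), Env.set_of_ne _ (by simp)]
  have ht : Denotes (sys N) (v .T : Form Q) ((η.set .T t).set .H x) t :=
    Denotes.var_set (by simp) Denotes.var_self
  have hx : Denotes (sys N) (v .H : Form Q) ((η.set .T t).set .H x) x := Denotes.var_self
  have hsucc : ∀ e : Q × Bool × Q × Bool × Dir, Holds (sys N)
      (app2 (r e.2.2.1) (app2 (write N k e.2.2.2.1) (v .T) (v .H))
        (.app (move N k e.2.2.2.2) (v .H))) ((η.set .T t).set .H x)
      fun s => s ∈ Dom.toSet (succDom g t x e) := fun e =>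
    Denotes.app (Denotes.app (hr _ hη _) (denotes_write _ ht hx)) ((denotes_move _).app hx)
  have hmem : ∀ a : Bool, a ∈ [true, false] := by simp
  generalize M.kind q = κ
  cases κ with
  | acc => exact holds_tt
  | rej => exact holds_ff
  | exist =>
    refine (holds_bigOr fun a _ => (holds_read a ht hx).and
      (holds_bigOr fun e _ => hsucc e)).congr fun s => ?_
    simp only [hmem, true_and, Finset.mem_toList, Finset.mem_filter, and_assoc]
  | univ =>
    refine (holds_bigOr fun a _ => (holds_read a ht hx).and
      (holds_bigAnd fun e _ => hsucc e)).congr fun s => ?_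
    simp only [hmem, true_and, Finset.mem_toList, Finset.mem_filter, and_imp]

/-- The value of `g` at the encoding of the configuration `c`. -/
noncomputable def valDom (g : Q → Dom (Fin N) (stTy k)) (c : Config Q) : Dom (Fin N) .pr :=
  apSt (g c.state) (tapeDom N k c.tape) ((counter N k).ofNat c.head.toNat)

theorem mem_ap_tapeDom (t : ℤ → Bool) {h : ℤ} (h0 : 0 ≤ h) (h1 : h < F k N) (s : Fin N) :
    s ∈ Dom.toSet (Dom.ap (tapeDom N k t) ((counter N k).ofNat h.toNat)) ↔ t h = true := by
  change t ((counter N k).toNat ((counter N k).ofNat h.toNat)) = true ↔ _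
  rw [Counter.toNat_ofNat _ (by rw [card_D]; omega), Int.toNat_of_nonneg h0]

/-- The configurations reached by a transition. -/
def nextConfig (c : Config Q) (e : Q × Bool × Q × Bool × Dir) : Config Q where
  state := e.2.2.1
  head := c.head + e.2.2.2.2.toInt
  tape := Function.update c.tape c.head e.2.2.2.1

theorem step_iff {c c' : Config Q} (hc : ¬ M.Halting c) : M.Step c c' ↔
    ∃ e ∈ M.delta, (e.1 = c.state ∧ e.2.1 = c.tape c.head) ∧ c' = nextConfig c e := by
  constructor
  · rintro ⟨-, b, d, he, hh, ht⟩
    refine ⟨_, he, ⟨rfl, rfl⟩, ?_⟩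
    cases c'
    simp only at hh ht
    subst hh ht
    rfl
  · rintro ⟨⟨q, a, q', b, d⟩, he, ⟨rfl, rfl⟩, rfl⟩
    exact ⟨hc, b, d, he, rfl, rfl⟩

variable {w : List Bool} (hb : ∀ c, M.Reachable w c → 0 ≤ c.head ∧ c.head < (F k N : ℤ))
include hb

/-- Encoding commutes with a transition. The space bound is used twice: at `c` for writing, and at
the successor for the head, which must not leave the tape to the left. -/
theorem succDom_eq {c : Config Q} (hr : M.Reachable w c) (hc : ¬ M.Halting c)
    (g : Q → Dom (Fin N) (stTy k)) {e : Q × Bool × Q × Bool × Dir} (he : e ∈ M.delta)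
    (he' : e.1 = c.state ∧ e.2.1 = c.tape c.head) :
    succDom g (tapeDom N k c.tape) ((counter N k).ofNat c.head.toNat) e =
      valDom g (nextConfig c e) := by
  have hr' : M.Reachable w (nextConfig c e) :=
    hr.tail ((step_iff hc).2 ⟨e, he, he', rfl⟩)
  rw [succDom, tapeDom_update (hb c hr).1 (hb c hr).2,
    moveDom_ofNat _ (hb c hr).1 (hb _ hr').1]
  rfl

/-- Exactly one of the disjuncts over the letter `a` survives, the one for the scanned symbol, so
what remains quantifies over the successors of `c`. -/
theorem mem_valDom_rowDom {c : Config Q} (hr : M.Reachable w c)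
    (g : Q → Dom (Fin N) (stTy k)) (s : Fin N) :
    s ∈ Dom.toSet (valDom (fun q => rowDom M q g) c) ↔
      match M.kind c.state with
      | .acc => True
      | .rej => False
      | .exist => ∃ c', M.Step c c' ∧ s ∈ Dom.toSet (valDom g c')
      | .univ => ∀ c', M.Step c c' → s ∈ Dom.toSet (valDom g c') := by
  have hread := mem_ap_tapeDom (k := k) c.tape (hb c hr).1 (hb c hr).2 s
  change (match M.kind c.state with | .acc => _ | .rej => _ | .exist => _ | .univ => _) ↔ _
  cases hk : M.kind c.state with
  | acc => exact Iff.rfl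
  | rej => exact Iff.rfl
  | exist =>
    have hc : ¬ M.Halting c := by simp [ATM.Halting, hk]
    constructor
    · rintro ⟨a, ha, e, he, ⟨h1, h2⟩, hs⟩
      have ha' : a = c.tape c.head := Bool.eq_iff_iff.2 (ha.symm.trans hread)
      rw [succDom_eq hb hr hc g he ⟨h1, h2.trans ha'⟩] at hs
      exact ⟨_, (step_iff hc).2 ⟨e, he, ⟨h1, h2.trans ha'⟩, rfl⟩, hs⟩
    · rintro ⟨c', hstep, hs⟩
      obtain ⟨e, he, he', rfl⟩ := (step_iff hc).1 hstep
      exact ⟨c.tape c.head, hread, e, he, he', by rwa [succDom_eq hb hr hc g he he']⟩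
  | univ =>
    have hc : ¬ M.Halting c := by simp [ATM.Halting, hk]
    constructor
    · rintro ⟨a, ha, hs⟩ c' hstep
      have ha' : a = c.tape c.head := Bool.eq_iff_iff.2 (ha.symm.trans hread)
      obtain ⟨e, he, he', rfl⟩ := (step_iff hc).1 hstep
      rw [← succDom_eq hb hr hc g he he']
      exact hs e he ⟨he'.1, he'.2.trans ha'.symm⟩
    · intro h
      refine ⟨c.tape c.head, hread, fun e he he' => ?_⟩
      rw [succDom_eq hb hr hc g he he']
      exact h _ ((step_iff hc).2 ⟨e, he, he', rfl⟩)

/-- Induction on the tree: prefixedness at each node turns membership of the children into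
membership of the node. -/
theorem mem_valDom_of_accepting {g : Q → Dom (Fin N) (stTy k)} (hg : ∀ q, rowDom M q g ≤ g q)
    {c : Config Q} (t : M.CompTree c) (ht : t.Accepting) (hr : M.Reachable w c) (s : Fin N) :
    s ∈ Dom.toSet (valDom g c) := by
  induction t with
  | leaf c h =>
    have hk : M.kind c.state = .acc := ht
    refine (stTy_le_iff _ _).1 (hg c.state) _ _ s ((mem_valDom_rowDom hb hr g s).2 ?_)
    rw [hk]
    trivial
  | exist c c' h hs t ih =>
    refine (stTy_le_iff _ _).1 (hg c.state) _ _ s ((mem_valDom_rowDom hb hr g s).2 ?_)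
    rw [h]
    exact ⟨c', hs, ih ht (hr.tail hs)⟩
  | univ c h hs t ih =>
    refine (stTy_le_iff _ _).1 (hg c.state) _ _ s ((mem_valDom_rowDom hb hr g s).2 ?_)
    rw [h]
    exact fun c' hs => ih c' hs (ht c' hs) (hr.tail hs)

/-- The vector that is empty exactly at the encodings of reachable configurations without an
accepting computation tree. -/
noncomputable def boundDom (N k : ℕ) (M : ATM Q) (w : List Bool) (q : Q) : Dom (Fin N) (stTy k) :=
  Dom.mk fun t : D N (k + 1) => Dom.mk fun x : D N k => Dom.ofSet {_s |
    ∀ c, M.Reachable w c → c.state = q → tapeDom N k c.tape = t →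
      (counter N k).ofNat c.head.toNat = x → ∃ t : M.CompTree c, t.Accepting}

omit hb in
theorem exists_accepting_of_mem_valDom_boundDom {c : Config Q} (hr : M.Reachable w c) {s : Fin N}
    (h : s ∈ Dom.toSet (valDom (boundDom N k M w) c)) : ∃ t : M.CompTree c, t.Accepting :=
  h c hr rfl rfl rfl

/-- `boundDom` is the full set at arguments that encode no reachable configuration, so only
reachable ones are to be checked. There one move of the game extends accepting trees of successors
to a tree of `c`. Quantifying over all configurations with a given encoding avoids any injectivity
of the encoding. -/
theorem rowDom_boundDom_le (hstuck : M.NeverStuck) (q : Q) :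
    rowDom M q (boundDom N k M w) ≤ boundDom N k M w q := by
  rw [stTy_le_iff]
  rintro t x s hs c hr rfl rfl rfl
  have h := (mem_valDom_rowDom hb hr _ s).1 hs
  cases hk : M.kind c.state with
  | acc => exact ⟨.leaf c (Or.inl hk), hk⟩
  | rej =>
    rw [hk] at h
    exact h.elim
  | exist =>
    rw [hk] at h
    obtain ⟨c', hstep, hs'⟩ := h
    obtain ⟨t, ht⟩ := exists_accepting_of_mem_valDom_boundDom (hr.tail hstep) hs'
    exact ⟨.exist c c' hk hstep t, ht⟩
  | univ =>
    rw [hk] at h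
    choose t ht using fun c' hstep =>
      exists_accepting_of_mem_valDom_boundDom (hr.tail hstep) (h c' hstep)
    have hc : ¬ M.Halting c := by simp [ATM.Halting, hk]
    -- A universal node needs at least one child; without `hstuck` a stuck universal configuration
    -- would satisfy its row vacuously.
    exact ⟨.univ c hk (hstuck w c hr hc) t, ht⟩

omit hb in
theorem denotes_Phi [Fintype Q] [DecidableEq Q] (hw : w.length ≤ N) (b : Q → Dom (Fin N) (stTy k)) :
    Denotes (sys N) (Phi N k M w) Env.empty (valDom (simSol (rowDom M) ∅ b) (M.init w)) :=
  Denotes.app (Denotes.app (denotes_simMu denotes_row (by simp) M.q0) (denotes_tape0 k w hw))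
    -- The head starts on cell `0`, and `ofNat 0` is the minimum by definition.
    (denotes_minF k)

end Machine

/-! ### Typing -/

section Typing
variable {P A V : Type} {Γ : Ctx V} {φ ψ β : Fml P A V}

@[simp]
theorem Ctx.compl_compl (Γ : Ctx V) : Γ.compl.compl = Γ := by
  funext X
  unfold Ctx.compl
  rcases Γ X with _ | ⟨u, τ⟩
  · rfl
  · cases u <;> rfl

theorem Ctx.extend_self (Γ : Ctx V) (X : V) (u : Variance) (τ : Ty) :
    Γ.extend X u τ X = some (u, τ) := by
  classical exact Function.update_self ..

theorem Ctx.extend_of_ne (Γ : Ctx V) {X Y : V} (h : Y ≠ X) (u : Variance) (τ : Ty) :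
    Γ.extend X u τ Y = Γ Y := by
  classical exact Function.update_of_ne h ..

theorem Ctx.compl_extend (Γ : Ctx V) (X : V) (u : Variance) (τ : Ty) :
    (Γ.extend X u τ).compl = Γ.compl.extend X u.compl τ := by
  funext Y
  by_cases h : Y = X
  · subst h
    simp only [Ctx.compl, Ctx.extend_self, Option.map_some]
  · simp only [Ctx.compl, Ctx.extend_of_ne _ h]

theorem HasType.var_extend {X Y : V} {u : Variance} {σ τ : Ty} (hne : Y ≠ X)
    (h : HasType Γ (.var Y : Fml P A V) τ) : HasType (Γ.extend X u σ) (.var Y : Fml P A V) τ := by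
  cases h with
  | var _ _ u' _ hu hY => exact .var _ _ u' _ hu (by rw [Ctx.extend_of_ne _ hne, hY])

theorem HasType.and (h₁ : HasType Γ φ .pr) (h₂ : HasType Γ ψ .pr) :
    HasType Γ (.and φ ψ) .pr :=
  .neg _ _ _ (.or _ _ _ (.neg _ _ _ (by simpa using h₁)) (.neg _ _ _ (by simpa using h₂)))

/-- `φ` has type `τ` both in `Γ` and in the complement of `Γ`. -/
def BiType (Γ : Ctx V) (φ : Fml P A V) (τ : Ty) : Prop := HasType Γ φ τ ∧ HasType Γ.compl φ τ

theorem BiType.compl {τ : Ty} (h : BiType Γ φ τ) : BiType Γ.compl φ τ :=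
  ⟨h.2, by simpa using h.1⟩

theorem BiType.neg {τ : Ty} (h : BiType Γ φ τ) : BiType Γ (.neg φ) τ :=
  ⟨.neg _ _ _ h.2, .neg _ _ _ (by simpa using h.1)⟩

theorem BiType.or (h₁ : BiType Γ φ .pr) (h₂ : BiType Γ ψ .pr) : BiType Γ (.or φ ψ) .pr :=
  ⟨.or _ _ _ h₁.1 h₂.1, .or _ _ _ h₁.2 h₂.2⟩

theorem BiType.dia {a : A} (h : BiType Γ φ .pr) : BiType Γ (.dia a φ) .pr :=
  ⟨.dia _ _ _ h.1, .dia _ _ _ h.2⟩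

theorem BiType.and (h₁ : BiType Γ φ .pr) (h₂ : BiType Γ ψ .pr) : BiType Γ (.and φ ψ) .pr :=
  (h₁.neg.or h₂.neg).neg

theorem BiType.imp (h₁ : BiType Γ φ .pr) (h₂ : BiType Γ ψ .pr) : BiType Γ (.imp φ ψ) .pr :=
  h₁.neg.or h₂

theorem BiType.iff (h₁ : BiType Γ φ .pr) (h₂ : BiType Γ ψ .pr) : BiType Γ (.iff φ ψ) .pr :=
  (h₁.imp h₂).and (h₂.imp h₁)

theorem BiType.box {a : A} (h : BiType Γ φ .pr) : BiType Γ (.box a φ) .pr := h.neg.dia.neg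

theorem BiType.ite (h : BiType Γ β .pr) (h₁ : BiType Γ φ .pr) (h₂ : BiType Γ ψ .pr) :
    BiType Γ (.ite β φ ψ) .pr := (h.and h₁).or (h.neg.and h₂)

/-- Only the argument has to be typed in both contexts; the function may contain positive variables.
The fixpoint variables rely on this. -/
theorem HasType.app_zero {σ τ : Ty} (h₁ : HasType Γ φ (.arr σ .zero τ)) (h₂ : BiType Γ ψ σ) :
    HasType Γ (.app φ ψ) τ := .appZero _ _ _ _ _ h₁ h₂.1 h₂.2

theorem BiType.app {σ τ : Ty} (h₁ : BiType Γ φ (.arr σ .zero τ)) (h₂ : BiType Γ ψ σ) :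
    BiType Γ (.app φ ψ) τ := ⟨h₁.1.app_zero h₂, h₁.2.app_zero h₂.compl⟩

theorem BiType.lam {X : V} {σ τ : Ty} (h : BiType (Γ.extend X .zero σ) φ τ) :
    BiType Γ (.lam X .zero σ φ) (.arr σ .zero τ) :=
  ⟨.lam _ _ _ _ _ _ h.1, .lam _ _ _ _ _ _ (by have := h.2; rwa [Ctx.compl_extend] at this)⟩

theorem BiType.var_self {X : V} {τ : Ty} : BiType (Γ.extend X .zero τ) (.var X : Fml P A V) τ := by
  refine ⟨.var _ _ .zero _ (Or.inl rfl) (Ctx.extend_self ..), ?_⟩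
  rw [Ctx.compl_extend]
  exact .var _ _ .zero _ (Or.inl rfl) (Ctx.extend_self ..)

theorem BiType.var_extend {X Y : V} {u : Variance} {σ τ : Ty} (hne : Y ≠ X)
    (h : BiType Γ (.var Y : Fml P A V) τ) : BiType (Γ.extend X u σ) (.var Y : Fml P A V) τ := by
  refine ⟨h.1.var_extend hne, ?_⟩
  rw [Ctx.compl_extend]
  exact h.2.var_extend hne

end Typing

-- Types of the macros, the rows and the whole formula

section MacroTyping
variable {Q : Type} {Γ : Ctx (Vr Q)} {N k : ℕ}

theorem hasType_ff (Γ : Ctx (Vr Q)) : HasType Γ (ff : Form Q) .pr :=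
  .mu _ _ _ _ (.var _ _ .pos _ (Or.inr rfl) (Ctx.extend_self ..))

theorem biType_ff : BiType Γ (ff : Form Q) .pr := ⟨hasType_ff _, hasType_ff _⟩

theorem biType_tt : BiType Γ (tt : Form Q) .pr := biType_ff.neg

theorem biType_letter (a : Bool) : BiType Γ (letter a : Form Q) .pr := by
  cases a
  · exact biType_ff
  · exact biType_tt

theorem hasType_bigOr {l : List (Form Q)} (h : ∀ φ ∈ l, HasType Γ φ .pr) :
    HasType Γ (bigOr l) .pr := by
  induction l with
  | nil => exact hasType_ff _
  | cons φ l ih => exact .or _ _ _ (h φ (by simp)) (ih fun ψ hψ => h ψ (by simp [hψ]))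

theorem hasType_bigAnd {l : List (Form Q)} (h : ∀ φ ∈ l, HasType Γ φ .pr) :
    HasType Γ (bigAnd l) .pr := by
  induction l with
  | nil => exact biType_tt.1
  | cons φ l ih => exact .and (h φ (by simp)) (ih fun ψ hψ => h ψ (by simp [hψ]))

theorem biType_bigOr {ι : Type} {l : List ι} {f : ι → Form Q} (h : ∀ i ∈ l, BiType Γ (f i) .pr) :
    BiType Γ (bigOr (l.map f)) .pr :=
  ⟨hasType_bigOr (List.forall_mem_map.2 fun i hi => (h i hi).1),
    hasType_bigOr (List.forall_mem_map.2 fun i hi => (h i hi).2)⟩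

theorem biType_bigAnd {ι : Type} {l : List ι} {f : ι → Form Q} (h : ∀ i ∈ l, BiType Γ (f i) .pr) :
    BiType Γ (bigAnd (l.map f)) .pr :=
  ⟨hasType_bigAnd (List.forall_mem_map.2 fun i hi => (h i hi).1),
    hasType_bigAnd (List.forall_mem_map.2 fun i hi => (h i hi).2)⟩

theorem biType_bit (i : ℕ) : BiType Γ (bit i : Form Q) .pr := by
  induction i using Nat.strong_induction_on with
  | _ i ih =>
    cases i with
    | zero => rw [bit]; exact biType_ff.box
    | succ i =>
      rw [bit]
      exact (ih i (by omega)).dia.and (biType_bigOr fun j _ => ih j.1 (by omega)).box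

theorem biType_app2 {σ τ ρ : Ty} {f φ ψ : Form Q}
    (hf : BiType Γ f (.arr σ .zero (.arr τ .zero ρ))) (h₁ : BiType Γ φ σ) (h₂ : BiType Γ ψ τ) :
    BiType Γ (app2 f φ ψ) ρ := (hf.app h₁).app h₂

theorem biType_inc0 : BiType Γ (inc0 : Form Q) (.arr .pr .zero .pr) :=
  .lam (.iff .var_self (BiType.neg .var_self).dia)

theorem biType_dec0 : BiType Γ (dec0 : Form Q) (.arr .pr .zero .pr) :=
  .lam (.iff .var_self (BiType.dia .var_self))

theorem biType_eq0 : BiType Γ (eq0 : Form Q) (.arr .pr .zero (.arr .pr .zero .pr)) :=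
  .lam (.lam (.box (.iff (.var_extend (by simp) .var_self) .var_self)))

theorem biType_lt0 : BiType Γ (lt0 N : Form Q) (.arr .pr .zero (.arr .pr .zero .pr)) :=
  .lam (.lam (biType_bigOr fun k _ => .box (.and
    (.imp (biType_bit k) (.and (BiType.neg (.var_extend (by simp) .var_self)) .var_self))
    (biType_bigAnd fun h _ => .imp (biType_bit h)
      (.iff (.var_extend (by simp) .var_self) .var_self)))))

theorem biType_minF (k : ℕ) : BiType Γ (minF k : Form Q) (tau k) := by
  cases k with
  | zero => exact biType_ff
  | succ k => exact .lam biType_ff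

theorem biType_existsOf {inc : Form Q}
    (hinc : ∀ Γ, BiType Γ inc (.arr (tau k) .zero (tau k))) :
    BiType Γ (existsOf k inc) (.arr (tau (k + 1)) .zero .pr) := by
  refine .lam (.app ?_ (biType_minF k))
  -- The fixpoint variable `Z` is positive, so the body of `μ` is not typable in the complement of
  -- its own context. Both halves are instead typed from outside the binder, where only `P` is free.
  suffices h : ∀ Γ, BiType Γ (.var .P : Form Q) (tau (k + 1)) → HasType Γ _ _ from
    ⟨h _ .var_self, h _ BiType.var_self.compl⟩
  intro Γ h
  refine .mu _ _ (.arr (tau k) .zero .pr) _ (.lam _ _ _ _ _ _ (.or _ _ _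
    (HasType.app_zero (σ := tau k) ?_ .var_self)
    (HasType.app_zero (σ := tau k) ?_ (.app (hinc _) .var_self))))
  · exact (h.1.var_extend (by simp)).var_extend (by simp)
  · exact HasType.var_extend (by simp) (.var _ _ .pos _ (Or.inr rfl) (Ctx.extend_self ..))

theorem biType_app_existsOf {inc φ : Form Q} {x : Vr Q}
    (hinc : ∀ Γ, BiType Γ inc (.arr (tau k) .zero (tau k)))
    (h : BiType (Γ.extend x .zero (tau k)) φ .pr) :
    BiType Γ (.app (existsOf k inc) (lam x (tau k) φ)) .pr :=
  (biType_existsOf hinc).app (.lam h)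

theorem biType_app_forallOf {inc φ : Form Q} {x : Vr Q}
    (hinc : ∀ Γ, BiType Γ inc (.arr (tau k) .zero (tau k)))
    (h : BiType (Γ.extend x .zero (tau k)) φ .pr) :
    BiType Γ (.app (forallOf k inc) (lam x (tau k) φ)) .pr := by
  have hall : BiType Γ (forallOf k inc) (.arr (tau (k + 1)) .zero .pr) :=
    .lam ((biType_existsOf hinc).app (BiType.neg .var_self)).neg
  exact hall.app (.lam h)

theorem BiType.ap {φ ψ : Form Q} (h₁ : BiType Γ φ (tau (k + 1))) (h₂ : BiType Γ ψ (tau k)) :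
    BiType Γ (.app φ ψ) .pr := BiType.app h₁ h₂

theorem biType_stepOf {inc lt e s : Form Q}
    (hinc : ∀ Γ, BiType Γ inc (.arr (tau k) .zero (tau k)))
    (hlt : ∀ Γ, BiType Γ lt (.arr (tau k) .zero (.arr (tau k) .zero .pr)))
    (he : ∀ Γ, BiType Γ e .pr) (hs : ∀ Γ, BiType Γ s (.arr .pr .zero .pr)) :
    BiType Γ (stepOf k inc lt e s) (.arr (tau (k + 1)) .zero (tau (k + 1))) := by
  have hI : ∀ Γ : Ctx (Vr Q), BiType ((Γ.extend .I .zero (tau (k + 1))).extend .X .zero (tau k))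
      (v .I : Form Q) (tau (k + 1)) := fun Γ => .var_extend (by simp) .var_self
  refine .lam (BiType.lam (.ite (biType_app_existsOf hinc (.and
    (biType_app2 (hlt _) .var_self (.var_extend (by simp) .var_self))
    (BiType.neg (biType_app2 biType_eq0 (.ap (.var_extend (by simp) (hI _)) .var_self)
      (he _))))) (.ap (hI _) .var_self) (.app (hs _) (.ap (hI _) .var_self))))

theorem biType_inc_lt (N k : ℕ) :
    (∀ Γ, BiType Γ (inc N k : Form Q) (.arr (tau k) .zero (tau k))) ∧
      ∀ Γ, BiType Γ (lt N k : Form Q) (.arr (tau k) .zero (.arr (tau k) .zero .pr)) := by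
  induction k with
  | zero =>
    refine ⟨fun Γ => ?_, fun Γ => ?_⟩
    · rw [inc]; exact biType_inc0
    · rw [lt]; exact biType_lt0
  | succ k ih =>
    refine ⟨fun Γ => ?_, fun Γ => ?_⟩
    · rw [inc]
      exact biType_stepOf ih.1 ih.2 (fun _ => biType_tt) fun _ => biType_inc0
    · rw [lt]
      have hI : BiType ((Γ.extend .I .zero (tau (k + 1))).extend .J .zero (tau (k + 1)))
        (v .I : Form Q) (tau (k + 1)) := .var_extend (by simp) .var_self
      have hJ : BiType ((Γ.extend .I .zero (tau (k + 1))).extend .J .zero (tau (k + 1)))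
        (v .J : Form Q) (tau (k + 1)) := .var_self
      refine .lam (.lam (biType_app_existsOf ih.1 (.and (biType_app2 biType_lt0
        (.ap (hI.var_extend (by simp)) .var_self) (.ap (hJ.var_extend (by simp)) .var_self))
        (biType_app_forallOf ih.1 (.imp
          (biType_app2 (.lam (.lam (biType_app2 (ih.2 _) .var_self
            (.var_extend (by simp) .var_self)))) .var_self (.var_extend (by simp) .var_self))
          (biType_app2 biType_eq0
            (.ap ((hI.var_extend (by simp)).var_extend (by simp)) .var_self)
            (.ap ((hJ.var_extend (by simp)).var_extend (by simp)) .var_self)))))))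

theorem biType_inc (N k : ℕ) : BiType Γ (inc N k : Form Q) (.arr (tau k) .zero (tau k)) :=
  (biType_inc_lt N k).1 Γ

theorem biType_dec (N k : ℕ) : BiType Γ (dec N k : Form Q) (.arr (tau k) .zero (tau k)) := by
  cases k with
  | zero => exact biType_dec0
  | succ k =>
    exact biType_stepOf (biType_inc_lt N k).1 (biType_inc_lt N k).2 (fun _ => biType_ff)
      fun _ => biType_dec0

theorem biType_eq (N k : ℕ) :
    BiType Γ (eq N k : Form Q) (.arr (tau k) .zero (.arr (tau k) .zero .pr)) := by
  cases k with
  | zero => exact biType_eq0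
  | succ k =>
    exact .lam (.lam (biType_app_forallOf (biType_inc_lt N k).1 (biType_app2 biType_eq0
      (.ap (.var_extend (by simp) (.var_extend (by simp) .var_self)) .var_self)
      (.ap (.var_extend (by simp) .var_self) .var_self))))

theorem biType_caseOf {l : List (Form Q × Form Q)} {ψ : Form Q}
    (h₁ : ∀ y ∈ l, ∀ Γ, BiType Γ y.1 (tau k)) (h₂ : ∀ y ∈ l, ∀ Γ, BiType Γ y.2 .pr)
    (hψ : ∀ Γ, BiType Γ ψ .pr) : BiType Γ (caseOf N k l ψ) (tau (k + 1)) :=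
  .lam (.or
    (biType_bigOr fun y hy => .and (biType_app2 (biType_eq N k) .var_self (h₁ y hy _)) (h₂ y hy _))
    (.and (hψ _) (biType_bigAnd fun y hy =>
      .or (BiType.neg (biType_app2 (biType_eq N k) .var_self (h₁ y hy _))) (h₂ y hy _).neg)))

theorem biType_chi (N k i : ℕ) : BiType Γ (chi N k i : Form Q) (tau k) := by
  have h0 : ∀ Γ, BiType Γ (chi0 N i : Form Q) .pr := fun _ => biType_bigOr fun j _ => biType_bit j
  cases k with
  | zero => exact h0 _
  | succ k =>
    refine biType_caseOf ?_ ?_ fun _ => biType_ff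
    · simpa using fun Γ => biType_minF k
    · simpa using h0

theorem biType_tape0 (N k : ℕ) (w : List Bool) :
    BiType Γ (tape0 N k w : Form Q) (tau (k + 1)) :=
  biType_caseOf (List.forall_mem_map.2 fun _ _ _ => biType_chi N k _)
    (List.forall_mem_map.2 fun _ _ _ => biType_letter _) fun _ => biType_ff

theorem biType_read (k : ℕ) (a : Bool) :
    BiType Γ (read k a : Form Q) (.arr (tau (k + 1)) .zero (.arr (tau k) .zero .pr)) := by
  have h : BiType ((Γ.extend .T .zero (tau (k + 1))).extend .H .zero (tau k))
      (.app (v .T) (v .H) : Form Q) .pr := .ap (.var_extend (by simp) .var_self) .var_self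
  refine .lam (.lam ?_)
  cases a
  · exact h.neg
  · exact h

theorem biType_write (N k : ℕ) (a : Bool) : BiType Γ (write N k a : Form Q)
    (.arr (tau (k + 1)) .zero (.arr (tau k) .zero (tau (k + 1)))) :=
  .lam (.lam (BiType.lam (.ite
    (biType_app2 (biType_eq N k) (.var_extend (by simp) .var_self) .var_self) (biType_letter a)
    (.ap (.var_extend (by simp) (.var_extend (by simp) .var_self)) .var_self))))

theorem biType_move (N k : ℕ) (d : Dir) :
    BiType Γ (move N k d : Form Q) (.arr (tau k) .zero (tau k)) := by
  cases d with
  | left => exact biType_dec N k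
  | stay => exact .lam .var_self
  | right => exact biType_inc N k

/-- Plain typing of the `r q'` suffices, since they stand only in function position and under no
negation except the double one hidden in `∧`. -/
theorem hasType_row [DecidableEq Q] (M : ATM Q) (q : Q) (r : Q → Form Q)
    (hr : ∀ Γ' : Ctx (Vr Q), (∀ q, Γ' (.st q) = Γ (.st q)) → ∀ q', HasType Γ' (r q') (stTy k)) :
    HasType Γ (row N k M q r) (stTy k) := by
  refine .lam _ _ _ _ _ _ (.lam _ _ _ _ _ _ ?_)
  let Γ' := (Γ.extend .T .zero (tau (k + 1))).extend .H .zero (tau k)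
  have hΓ : ∀ q, Γ' (.st q) = Γ (.st q) := fun q => by
    simp only [Γ', Ctx.extend_of_ne, ne_eq, reduceCtorEq, not_false_eq_true]
  have hT : BiType Γ' (v .T : Form Q) (tau (k + 1)) := .var_extend (by simp) .var_self
  have hH : BiType Γ' (v .H : Form Q) (tau k) := .var_self
  have hread : ∀ a, HasType Γ' (app2 (read k a) (v .T) (v .H) : Form Q) .pr := fun a =>
    (biType_app2 (biType_read k a) hT hH).1
  have hsucc : ∀ a, ∀ φ ∈ succs N k M r q a, HasType Γ' φ .pr := fun a =>
    List.forall_mem_map.2 fun e _ => HasType.app_zero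
      (HasType.app_zero (hr Γ' hΓ _) (biType_app2 (biType_write N k _) hT hH))
      ((biType_move N k _).app hH)
  generalize M.kind q = κ
  cases κ with
  | acc => exact biType_tt.1
  | rej => exact hasType_ff _
  | exist =>
    exact hasType_bigOr (List.forall_mem_map.2 fun a _ => (hread a).and (hasType_bigOr (hsucc a)))
  | univ =>
    exact hasType_bigOr (List.forall_mem_map.2 fun a _ => (hread a).and (hasType_bigAnd (hsucc a)))

theorem hasType_simMu [Fintype Q] [DecidableEq Q] (M : ATM Q) {B : Finset Q} {Γ : Ctx (Vr Q)}
    (hΓ : ∀ q ∈ B, Γ (.st q) = some (.pos, stTy k)) (q : Q) :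
    HasType Γ (simMu (stTy k) (row N k M) B q) (stTy k) := by
  induction B using compl_insert_induction generalizing Γ q with
  | step B ih =>
    rw [simMu]
    by_cases hq : q ∈ B
    · rw [dif_pos hq]
      exact .var _ _ .pos _ (Or.inr rfl) (hΓ q hq)
    · rw [dif_neg hq]
      refine .mu _ _ _ _ (hasType_row M q _ fun Γ' hΓ' q' => ih q hq (fun q'' hq'' => ?_) q')
      rw [hΓ']
      by_cases h : q'' = q
      · subst h
        exact Ctx.extend_self ..
      · rw [Ctx.extend_of_ne _ (by simpa using h)]
        exact hΓ q'' (Finset.mem_of_mem_insert_of_ne hq'' h)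

theorem hasType_Phi [Fintype Q] [DecidableEq Q] (N k : ℕ) (M : ATM Q) (w : List Bool) :
    HasType Ctx.empty (Phi N k M w) .pr :=
  ((hasType_simMu M (by simp) M.q0).app_zero (biType_tape0 N k w)).app_zero (biType_minF k)

end MacroTyping
end HFL

-- Acceptance and the least fixpoint

theorem mainTheorem9 {Q : Type} [Fintype Q] [DecidableEq Q] (k : ℕ) (hk : 1 ≤ k)
    (p : ℕ → ℕ) (hp : ∀ n, n < p n) (M : HFL.ATM Q)
    (hspace : M.SpaceBounded fun n => HFL.F k (p n)) (hstuck : M.NeverStuck)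
    (w : List Bool) :
    HFL.HasType HFL.Ctx.empty (HFL.Phi (p w.length) k M w) HFL.Ty.pr ∧
    (w ∈ M.language →
      HFL.den (HFL.sys (p w.length)) (HFL.Phi (p w.length) k M w) HFL.Env.empty =
        some ⟨HFL.Ty.pr, HFL.Dom.ofSet Set.univ⟩) ∧
    (w ∉ M.language →
      HFL.den (HFL.sys (p w.length)) (HFL.Phi (p w.length) k M w) HFL.Env.empty =
        some ⟨HFL.Ty.pr, HFL.Dom.ofSet ∅⟩) := by
  let N := p w.length
  let g : Q → HFL.Dom (Fin N) (HFL.stTy k) := HFL.simSol (HFL.rowDom M) ∅ fun _ => ⊥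
  have hden : HFL.Holds (HFL.sys N) (HFL.Phi N k M w) HFL.Env.empty
      fun s => s ∈ HFL.Dom.toSet (HFL.valDom g (M.init w)) :=
    HFL.denotes_Phi (hp w.length).le _
  have hb : ∀ c, M.Reachable w c → 0 ≤ c.head ∧ c.head < (HFL.F k N : ℤ) := hspace w
  have hinit : M.Reachable w (M.init w) := Relation.ReflTransGen.refl
  refine ⟨HFL.hasType_Phi N k M w, ?_, fun hw => ?_⟩
  · rintro ⟨t, ht⟩
    have h : HFL.Holds (HFL.sys N) (HFL.Phi N k M w) HFL.Env.empty fun _ => True :=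
      hden.congr fun s => iff_true_intro (HFL.mem_valDom_of_accepting hb
        (fun q => HFL.row_simSol_le HFL.rowDom_mono (Finset.notMem_empty q)) t ht hinit s)
    exact h
  · have h : HFL.Holds (HFL.sys N) (HFL.Phi N k M w) HFL.Env.empty fun _ => False := by
      refine hden.congr fun s => iff_false_intro fun hs => hw ?_
      -- Leastness rules out acceptance through infinite runs: `boundDom` is a prefixed vector built
      -- from trees of finite height.
      have hle : g ≤ HFL.boundDom N k M w :=
        HFL.simSol_le HFL.rowDom_mono (by simp) fun q _ => HFL.rowDom_boundDom_le hb hstuck q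
      exact HFL.exists_accepting_of_mem_valDom_boundDom hinit
        ((HFL.stTy_le_iff _ _).1 (hle (M.init w).state) _ _ s hs)
    exact h
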